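/- Let $H$ be a complex Hilbert space with inner product $(\cdot,\cdot)$, linear in the first variable. For $\theta\in[0,\frac{\pi}{2})$ put $\Sigma_\theta=\{re^{i\alpha}: r\ge 0,\ |\alpha|\le\theta\}$. A sesquilinear form $\mathfrak a$ in $H$ with domain a subspace $D(\mathfrak a)\subset H$ (not necessarily dense) is *sectorial* with vertex $\gamma\in\mathbb R$ and semi-angle $\theta$ if $\mathfrak a(u)-\gamma\|u\|^2\in\Sigma_\theta$ for all $u\in D(\mathfrak a)$, where $\mathfrak a(u)=\mathfrak a(u,u)$; it is *closed* if $D(\mathfrak a)$ is complete for the norm $(\operatorname{Re}\mathfrak a(u)+(1-\gamma)\|u\|^2)^{1/2}$. The *graph associated with* a sectorial form $\mathfrak a$ is the set of all $(x,f)\in H\times H$ for which there is a sequence $(u_k)$ in $D(\mathfrak a)$ with $u_k\to x$ in $H$, with $\{\mathfrak a(u_k):k\in\mathbb N\}$ bounded, and with $\mathfrak a(u_k,v)\to(f,v)$ for all $v\in D(\mathfrak a)$. A *graph* in $H$ is a subspace $A$ of $H\times H$, and $A+\lambda I=\{(x,y+\lambda x):(x,y)\in A\}$ for $\lambda\in\mathbb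 C$. It is an *operator* if $(0,y)\in A$ implies $y=0$. It is *invertible* if it is closed, for every $y\in H$ there is $x$ with $(x,y)\in A$, and $(x,0)\in A$ implies $x=0$; then $A^{-1}y=x$ for $(x,y)\in A$. It is *$m$-sectorial* with vertex $\gamma$ and semi-angle $\theta$ if the inner product of $x$ and $y$ lies in $\Sigma_\theta$ for every element $(x,y)$ of the graph $A-\gamma I$, and $A-(\gamma-1)I$ is invertible. For $m$-sectorial graphs $A_n,A$ with vertex $0$, $A_n\to A$ *in the strong resolvent sense* means that for all $\lambda\in\mathbb C$ with $\operatorname{Re}\lambda>0$ the graphs $A_n+\lambda I$ and $A+\lambda I$ are invertible and $(A_n+\lambda I)^{-1}f\to(A+\lambda I)^{-1}f$ in $H$ for all $f\in H$. **Theorem.** Fix $\theta\in[0,\frac{\pi}{2})$ and, for all $n\in\mathbb N=\{1,2,\dots\}$, let $\mathfrak b_n$ be a sectorial form in $H$ with vertex $0$ and semi-angle $\theta$. Let $\mathfrak a_n=\sum_{k=1}^n\mathfrak b_k$, with $D(\mathfrak a_n)=\bigcap_{k=1}^n D(\mathfrak b_k)$, and $$D(\mathfrak a_\infty)=\Big\{u\in\bigcap_{n=1}^\infty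 D(\mathfrak b_n):\ \sum_{n}\operatorname{Re}\mathfrak b_n(u)\text{ converges}\Big\}.$$ Then for all $u,v\in D(\mathfrak a_\infty)$ the series $\mathfrak a_\infty(u,v):=\sum_n\mathfrak b_n(u,v)$ converges. Let $A_n$ be the graph associated with $\mathfrak a_n$; it is $m$-sectorial with vertex $0$ and semi-angle $\theta$. (a) There is a graph $A_\infty$ in $H$, $m$-sectorial with vertex $0$ and semi-angle $\theta$, such that $A_n\to A_\infty$ in the strong resolvent sense. If $D(\mathfrak a_\infty)$ is dense in $H$, then all $A_n$ and $A_\infty$ are operators. (b) Suppose that $\mathfrak a_n$ is closed for all $n\in\mathbb N$. Then $\mathfrak a_\infty$ is closed and the graph $A_\infty$ in (a) is the graph associated with $\mathfrak a_\infty$ (whether or not $D(\mathfrak a_\infty)$ is dense). Moreover, for $\mathfrak a=\mathfrak a_n$ ($n\in\mathbb N$) and for $\mathfrak a=\mathfrak a_\infty$, the associated graph equals $\{(u,f)\in D(\mathfrak a)\times H:\mathfrak a(u,v)=(f,v)\text{ for all }v\in D(\mathfrak a)\}$. -/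

import Mathlib

open Filter Topology

/-- The closed sector `Σ_θ = {r e^{iα} : r ≥ 0, |α| ≤ θ}` in the complex plane. -/
def sector (θ : ℝ) : Set ℂ :=
  {z | ∃ r α : ℝ, 0 ≤ r ∧ |α| ≤ θ ∧ z = (r : ℂ) * Complex.exp ((α : ℂ) * Complex.I)}

theorem mem_sector_iff {θ : ℝ} (h0 : 0 ≤ θ) (hθ : θ < Real.pi / 2) {z : ℂ} :
    z ∈ sector θ ↔ 0 ≤ z.re ∧ |z.im| ≤ Real.tan θ * z.re := by
  have hcos : 0 < Real.cos θ := Real.cos_pos_of_mem_Ioo ⟨by linarith [Real.pi_pos], hθ⟩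
  constructor
  · rintro ⟨r, α, hr, hα, rfl⟩
    have hca : Real.cos θ ≤ Real.cos α := by
      rw [← Real.cos_abs α]
      exact Real.cos_le_cos_of_nonneg_of_le_pi (abs_nonneg α) (by linarith [Real.pi_pos]) hα
    have hpos : 0 < Real.cos α := hcos.trans_le hca
    rw [Complex.re_ofReal_mul, Complex.im_ofReal_mul, Complex.exp_ofReal_mul_I_re,
      Complex.exp_ofReal_mul_I_im]
    refine ⟨mul_nonneg hr hpos.le, ?_⟩
    obtain ⟨h1, h2⟩ := abs_le.1 hα
    have hI : ∀ x : ℝ, -θ ≤ x → x ≤ θ → x ∈ Set.Ioo (-(Real.pi / 2)) (Real.pi / 2) :=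
      fun x hx hx' => ⟨by linarith, by linarith⟩
    have ht : |Real.tan α| ≤ Real.tan θ := by
      refine abs_le.2 ⟨?_, ?_⟩
      · rw [← Real.tan_neg]
        exact Real.strictMonoOn_tan.monotoneOn (hI _ le_rfl (by linarith)) (hI _ h1 h2) h1
      · exact Real.strictMonoOn_tan.monotoneOn (hI _ h1 h2) (hI _ (by linarith) le_rfl) h2
    have hs : Real.sin α = Real.tan α * Real.cos α := (Real.tan_mul_cos hpos.ne').symm
    rw [hs, abs_mul, abs_of_nonneg hr, abs_mul, abs_of_pos hpos]
    calc r * (|Real.tan α| * Real.cos α) = |Real.tan α| * (r * Real.cos α) := by ring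
      _ ≤ Real.tan θ * (r * Real.cos α) :=
        mul_le_mul_of_nonneg_right ht (mul_nonneg hr hpos.le)
  · rintro ⟨hre, him⟩
    refine ⟨‖z‖, z.arg, norm_nonneg z, ?_, (Complex.norm_mul_exp_arg_mul_I z).symm⟩
    rcases hre.eq_or_lt with h | h
    · have hz : z = 0 := by
        rw [← h, mul_zero] at him
        exact Complex.ext h.symm (abs_nonpos_iff.1 him)
      simpa [hz] using h0
    · have ha : |z.arg| < Real.pi / 2 := Complex.abs_arg_lt_pi_div_two_iff.2 (Or.inl h)
      obtain ⟨ha1, ha2⟩ := abs_lt.1 ha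
      have hat : z.arg = Real.arctan (z.im / z.re) := by
        rw [← Complex.tan_arg, Real.arctan_tan ha1 ha2]
      have hth : θ = Real.arctan (Real.tan θ) := (Real.arctan_tan (by linarith) hθ).symm
      have hq : |z.im / z.re| ≤ Real.tan θ := by
        rw [abs_div, abs_of_pos h]
        exact (div_le_iff₀ h).2 him
      obtain ⟨hq1, hq2⟩ := abs_le.1 hq
      rw [hat, hth, abs_le, ← Real.arctan_neg]
      exact ⟨Real.arctan_mono hq1, Real.arctan_mono hq2⟩

theorem norm_le_of_mem_sector {θ : ℝ} (h0 : 0 ≤ θ) (hθ : θ < Real.pi / 2) {z : ℂ}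
    (hz : z ∈ sector θ) : ‖z‖ ≤ (1 + Real.tan θ) * z.re := by
  obtain ⟨h1, h2⟩ := (mem_sector_iff h0 hθ).1 hz
  have := Complex.norm_le_abs_re_add_abs_im z
  rw [abs_of_nonneg h1] at this
  linarith

/-- A sesquilinear form in `H`: a (not necessarily dense or closed) subspace `D(𝔞)` of `H` and a map
`D(𝔞) × D(𝔞) → ℂ`, linear in the first and conjugate-linear in the second variable. -/
structure SesqForm (H : Type*) [NormedAddCommGroup H] [InnerProductSpace ℂ H] where
  domain : Submodule ℂ H
  toFun : domain →ₗ[ℂ] domain →ₗ⋆[ℂ] ℂ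

namespace SesqForm

variable {H : Type*} [NormedAddCommGroup H] [InnerProductSpace ℂ H]

/-- `𝔞` is sectorial with vertex `γ` and semi-angle `θ`:
`𝔞(u) - γ ‖u‖² ∈ Σ_θ` for all `u ∈ D(𝔞)`, where `0 ≤ θ < π / 2`. -/
def IsSectorialWith (a : SesqForm H) (γ θ : ℝ) : Prop :=
  0 ≤ θ ∧ θ < Real.pi / 2 ∧
    ∀ u : a.domain, a.toFun u u - ((γ * ‖(u : H)‖ ^ 2 : ℝ) : ℂ) ∈ sector θ

/-- `𝔞` is sectorial: it has some vertex and some semi-angle. -/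
def IsSectorial (a : SesqForm H) : Prop := ∃ γ θ : ℝ, a.IsSectorialWith γ θ

/-- The norm `‖u‖_{D(𝔞)} = (Re 𝔞(u) + (1 - γ) ‖u‖²)^{1/2}` of a sectorial form with vertex `γ`. -/
noncomputable def formNorm (a : SesqForm H) (γ : ℝ) (u : a.domain) : ℝ :=
  √((a.toFun u u).re + (1 - γ) * ‖(u : H)‖ ^ 2)

/-- A sectorial form with vertex `γ` is closed if `(D(𝔞), ‖·‖_{D(𝔞)})` is complete: every Cauchy
sequence converges. -/
def IsClosedWith (a : SesqForm H) (γ : ℝ) : Prop :=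
  ∀ u : ℕ → a.domain,
    (∀ ε : ℝ, 0 < ε → ∃ N, ∀ m ≥ N, ∀ n ≥ N, a.formNorm γ (u m - u n) < ε) →
    ∃ w : a.domain, Tendsto (fun n => a.formNorm γ (u n - w)) atTop (𝓝 0)

/-- The restriction of `𝔞` to a subspace `p` of its domain. -/
def restrict (a : SesqForm H) (p : Submodule ℂ H) (h : p ≤ a.domain) :
    p →ₗ[ℂ] p →ₗ⋆[ℂ] ℂ :=
  LinearMap.mk₂'ₛₗ (RingHom.id ℂ) (starRingEnd ℂ)
    (fun u v => a.toFun (Submodule.inclusion h u) (Submodule.inclusion h v))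
    (fun u u' v => by simp) (fun c u v => by simp) (fun u v v' => by simp) (fun c u v => by simp)

/-- The partial sum `b 0 + ... + b n`, with domain `⋂_{k ≤ n} D(b k)`. -/
def partialSum (b : ℕ → SesqForm H) (n : ℕ) : SesqForm H where
  domain := ⨅ k : Fin (n + 1), (b k).domain
  toFun := ∑ k : Fin (n + 1), (b k).restrict _ (iInf_le _ k)

theorem partialSum_apply (b : ℕ → SesqForm H) (n : ℕ) (u v : (partialSum b n).domain) :
    (partialSum b n).toFun u v = ∑ k : Fin (n + 1),
      (b k).toFun ⟨u, Submodule.mem_iInf _ |>.1 u.2 k⟩ ⟨v, Submodule.mem_iInf _ |>.1 v.2 k⟩ := by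
  have h : ∀ (p : Submodule ℂ H) (f : Fin (n + 1) → p →ₗ[ℂ] p →ₗ⋆[ℂ] ℂ) (u v : p),
      (∑ k, f k) u v = ∑ k, f k u v := fun p f u v => by simp [LinearMap.sum_apply]
  exact h _ (fun k : Fin (n + 1) => (b k).restrict _ (iInf_le _ k)) u v

theorem partialSum_isSectorialWith {b : ℕ → SesqForm H} {θ : ℝ}
    (hb : ∀ n, (b n).IsSectorialWith 0 θ) (n : ℕ) : (partialSum b n).IsSectorialWith 0 θ := by
  obtain ⟨h0, hθ, -⟩ := hb 0
  refine ⟨h0, hθ, fun u => ?_⟩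
  have h : ∀ k : Fin (n + 1), _ := fun k =>
    (mem_sector_iff h0 hθ).1 ((hb k).2.2 ⟨u, Submodule.mem_iInf _ |>.1 u.2 k⟩)
  simp only [zero_mul, Complex.ofReal_zero, sub_zero] at h ⊢
  rw [mem_sector_iff h0 hθ, partialSum_apply, Complex.re_sum, Complex.im_sum, Finset.mul_sum]
  exact ⟨Finset.sum_nonneg fun k _ => (h k).1,
    (Finset.abs_sum_le_sum_abs _ _).trans (Finset.sum_le_sum fun k _ => (h k).2)⟩

theorem partialSum_isSectorial {b : ℕ → SesqForm H} {θ : ℝ}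
    (hb : ∀ n, (b n).IsSectorialWith 0 θ) (n : ℕ) : (partialSum b n).IsSectorial :=
  ⟨0, θ, partialSum_isSectorialWith hb n⟩

theorem IsSectorialWith.re_nonneg {a : SesqForm H} {θ : ℝ} (ha : a.IsSectorialWith 0 θ)
    (u : a.domain) : 0 ≤ (a.toFun u u).re := by
  have := ((mem_sector_iff ha.1 ha.2.1).1 (ha.2.2 u)).1
  simpa using this

theorem IsSectorialWith.norm_le {a : SesqForm H} {θ : ℝ} (ha : a.IsSectorialWith 0 θ)
    (u : a.domain) : ‖a.toFun u u‖ ≤ (1 + Real.tan θ) * (a.toFun u u).re := by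
  have := norm_le_of_mem_sector ha.1 ha.2.1 (ha.2.2 u)
  simpa using this

theorem apply_add_add_apply_sub (a : SesqForm H) (u v : a.domain) :
    a.toFun (u + v) (u + v) + a.toFun (u - v) (u - v)
      = 2 * a.toFun u u + 2 * a.toFun v v := by
  simp only [map_add, map_sub, LinearMap.add_apply, LinearMap.sub_apply]
  ring

theorem polarization (a : SesqForm H) (u v : a.domain) :
    a.toFun u v = (1 / 4 : ℂ) * (a.toFun (u + v) (u + v) - a.toFun (u - v) (u - v)
      + Complex.I * a.toFun (u + Complex.I • v) (u + Complex.I • v)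
      - Complex.I * a.toFun (u - Complex.I • v) (u - Complex.I • v)) := by
  simp only [map_add, map_sub, map_smul, LinearMap.map_smulₛₗ, LinearMap.add_apply,
    LinearMap.sub_apply, LinearMap.smul_apply, smul_eq_mul, Complex.conj_I]
  ring_nf
  simp only [Complex.I_sq]
  ring

/-- The subspace `{u ∈ ⋂_n D(b n) : ∑ Re b_n(u) converges}`. The terms are nonnegative, so that
summability is the same as convergence of the sequence of partial sums. -/
def seriesDomain (b : ℕ → SesqForm H) {θ : ℝ} (hb : ∀ n, (b n).IsSectorialWith 0 θ) :
    Submodule ℂ H where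
  carrier := {u | ∃ hu : ∀ n, u ∈ (b n).domain,
    Summable fun n => ((b n).toFun ⟨u, hu n⟩ ⟨u, hu n⟩).re}
  zero_mem' := by
    refine ⟨fun n => zero_mem _, ?_⟩
    have : ∀ n, (⟨0, zero_mem _⟩ : (b n).domain) = 0 := fun n => rfl
    simp [this]
  add_mem' := by
    rintro u v ⟨hu, hus⟩ ⟨hv, hvs⟩
    refine ⟨fun n => add_mem (hu n) (hv n), ?_⟩
    refine Summable.of_nonneg_of_le (fun n => (hb n).re_nonneg _) (fun n => ?_)
      ((hus.mul_left 2).add (hvs.mul_left 2))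
    have h := congrArg Complex.re (apply_add_add_apply_sub (b n) ⟨u, hu n⟩ ⟨v, hv n⟩)
    have h' := (hb n).re_nonneg (⟨u, hu n⟩ - ⟨v, hv n⟩)
    simp only [Complex.add_re, Complex.mul_re, Complex.re_ofNat, Complex.im_ofNat, zero_mul,
      sub_zero] at h
    change ((b n).toFun (⟨u, hu n⟩ + ⟨v, hv n⟩) (⟨u, hu n⟩ + ⟨v, hv n⟩)).re ≤ _
    linarith
  smul_mem' := by
    rintro c u ⟨hu, hus⟩
    refine ⟨fun n => Submodule.smul_mem _ c (hu n), ?_⟩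
    have h : ∀ n, ((b n).toFun ⟨c • u, Submodule.smul_mem _ c (hu n)⟩
        ⟨c • u, Submodule.smul_mem _ c (hu n)⟩).re
          = ‖c‖ ^ 2 * ((b n).toFun ⟨u, hu n⟩ ⟨u, hu n⟩).re := fun n => by
      have e : (⟨c • u, Submodule.smul_mem _ c (hu n)⟩ : (b n).domain) = c • ⟨u, hu n⟩ := rfl
      rw [e, LinearMap.map_smulₛₗ, LinearMap.map_smulₛₗ, LinearMap.smul_apply, smul_smul,
        ← Complex.re_ofReal_mul, smul_eq_mul, RingHom.id_apply, mul_comm _ c, Complex.mul_conj,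
        Complex.normSq_eq_norm_sq]
    simp only [h]
    exact hus.mul_left _

section Series

variable {b : ℕ → SesqForm H} {θ : ℝ} (hb : ∀ n, (b n).IsSectorialWith 0 θ)

theorem seriesDomain_le (n : ℕ) : seriesDomain b hb ≤ (b n).domain := fun _ hu => hu.1 n

theorem summable_diag (u : seriesDomain b hb) :
    Summable fun n => (b n).restrict _ (seriesDomain_le hb n) u u :=
  Summable.of_norm_bounded (u.2.2.mul_left (1 + Real.tan θ)) fun n => (hb n).norm_le _

theorem summable_series (u v : seriesDomain b hb) :
    Summable fun n => (b n).restrict _ (seriesDomain_le hb n) u v := by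
  have h := ((((summable_diag hb (u + v)).sub (summable_diag hb (u - v))).add
    ((summable_diag hb (u + Complex.I • v)).mul_left Complex.I)).sub
    ((summable_diag hb (u - Complex.I • v)).mul_left Complex.I)).mul_left (1 / 4 : ℂ)
  refine h.congr fun n => ?_
  exact (polarization (b n) (Submodule.inclusion (seriesDomain_le hb n) u)
    (Submodule.inclusion (seriesDomain_le hb n) v)).symm

end Series

/-- The form `𝔞_∞(u, v) = ∑ b_n(u, v)` on `{u ∈ ⋂_n D(b n) : ∑ Re b_n(u) converges}`. -/
noncomputable def seriesForm (b : ℕ → SesqForm H) {θ : ℝ}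
    (hb : ∀ n, (b n).IsSectorialWith 0 θ) : SesqForm H where
  domain := seriesDomain b hb
  toFun := LinearMap.mk₂'ₛₗ (RingHom.id ℂ) (starRingEnd ℂ)
    (fun u v => ∑' n, (b n).restrict _ (seriesDomain_le hb n) u v)
    (fun u u' v => by
      simp only [map_add, LinearMap.add_apply]
      exact (summable_series hb u v).tsum_add (summable_series hb u' v))
    (fun c u v => by
      simp only [map_smul, LinearMap.smul_apply, smul_eq_mul, RingHom.id_apply]
      exact tsum_mul_left)
    (fun u v v' => by
      simp only [map_add]
      exact (summable_series hb u v).tsum_add (summable_series hb u v'))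
    (fun c u v => by
      simp only [LinearMap.map_smulₛₗ, smul_eq_mul]
      exact tsum_mul_left)

theorem seriesForm_isSectorialWith {b : ℕ → SesqForm H} {θ : ℝ}
    (hb : ∀ n, (b n).IsSectorialWith 0 θ) : (seriesForm b hb).IsSectorialWith 0 θ := by
  obtain ⟨h0, hθ, -⟩ := hb 0
  refine ⟨h0, hθ, fun u => ?_⟩
  have h : ∀ n, _ := fun n => (mem_sector_iff h0 hθ).1
    ((hb n).2.2 (Submodule.inclusion (seriesDomain_le hb n) u))
  simp only [zero_mul, Complex.ofReal_zero, sub_zero] at h ⊢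
  have hs := (summable_diag hb u).hasSum
  have hre := Complex.hasSum_re hs
  have him := Complex.hasSum_im hs
  rw [mem_sector_iff h0 hθ]
  refine ⟨hre.nonneg fun n => (h n).1, abs_le.2 ⟨?_, ?_⟩⟩
  · rw [← mul_neg_one, ← sub_nonneg]
    refine ((him.sub ((hre.mul_left (Real.tan θ)).mul_right (-1))).nonneg fun n => ?_)
    have := (abs_le.1 (h n).2).1
    rw [mul_neg_one]
    exact sub_nonneg.2 this
  · exact hasSum_le (fun n => (abs_le.1 (h n).2).2) him (hre.mul_left (Real.tan θ))

theorem seriesForm_isSectorial {b : ℕ → SesqForm H} {θ : ℝ}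
    (hb : ∀ n, (b n).IsSectorialWith 0 θ) : (seriesForm b hb).IsSectorial :=
  ⟨0, θ, seriesForm_isSectorialWith hb⟩

theorem IsSectorialWith.norm_apply_add_le {a : SesqForm H} {γ θ : ℝ}
    (ha : a.IsSectorialWith γ θ) (u v : a.domain) :
    ‖a.toFun (u + v) (u + v)‖ ≤ (1 + Real.tan θ) *
      (2 * (‖a.toFun u u‖ + |γ| * ‖(u : H)‖ ^ 2) + 2 * (‖a.toFun v v‖ + |γ| * ‖(v : H)‖ ^ 2))
        + |γ| * ‖((u + v : a.domain) : H)‖ ^ 2 := by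
  obtain ⟨h0, hθ, hs⟩ := ha
  have ht : 0 ≤ Real.tan θ := Real.tan_nonneg_of_nonneg_of_le_pi_div_two h0 hθ.le
  have h1 := norm_le_of_mem_sector h0 hθ (hs (u + v))
  have h2 := ((mem_sector_iff h0 hθ).1 (hs (u - v))).1
  have h3 := congrArg Complex.re (apply_add_add_apply_sub a u v)
  have h4 := parallelogram_law_with_norm ℂ (u : H) (v : H)
  simp only [Complex.add_re, Complex.sub_re, Complex.mul_re, Complex.re_ofNat, Complex.im_ofNat,
    zero_mul, sub_zero, Complex.ofReal_re, Submodule.coe_add, Submodule.coe_sub] at h1 h2 h3 ⊢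
  have hsub : ‖a.toFun (u + v) (u + v)‖ ≤ ‖a.toFun (u + v) (u + v)
      - ((γ * ‖(u : H) + v‖ ^ 2 : ℝ) : ℂ)‖ + |γ| * ‖(u : H) + v‖ ^ 2 := by
    have := norm_add_le (a.toFun (u + v) (u + v) - ((γ * ‖(u : H) + v‖ ^ 2 : ℝ) : ℂ))
      ((γ * ‖(u : H) + v‖ ^ 2 : ℝ) : ℂ)
    rwa [sub_add_cancel, Complex.norm_real, Real.norm_eq_abs, abs_mul,
      abs_of_nonneg (sq_nonneg ‖(u : H) + v‖)] at this
  refine hsub.trans (add_le_add_left (h1.trans (mul_le_mul_of_nonneg_left ?_ (by linarith))) _)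
  have hu := Complex.re_le_norm (a.toFun u u)
  have hv := Complex.re_le_norm (a.toFun v v)
  have e : γ * ‖(u : H) + v‖ ^ 2 + γ * ‖(u : H) - v‖ ^ 2
      = 2 * (γ * ‖(u : H)‖ ^ 2) + 2 * (γ * ‖(v : H)‖ ^ 2) := by
    linear_combination γ * h4
  have gu : -(γ * ‖(u : H)‖ ^ 2) ≤ |γ| * ‖(u : H)‖ ^ 2 := by
    rw [← neg_mul]; exact mul_le_mul_of_nonneg_right (neg_le_abs γ) (sq_nonneg _)
  have gv : -(γ * ‖(v : H)‖ ^ 2) ≤ |γ| * ‖(v : H)‖ ^ 2 := by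
    rw [← neg_mul]; exact mul_le_mul_of_nonneg_right (neg_le_abs γ) (sq_nonneg _)
  linarith

/-- The graph associated with a (possibly neither closable nor densely defined) sectorial form `𝔞`:
all `(x, f)` for which there is a sequence `(u_n)` in `D(𝔞)` with `u_n → x` in `H`, with
`{𝔞(u_n)}` bounded, and with `𝔞(u_n, v) → (f, v)_H` for all `v ∈ D(𝔞)`. The inner product `(f, v)_H`
is linear in `f`, hence written `inner ℂ v f`. -/
def assocGraph (a : SesqForm H) (ha : a.IsSectorial) : Submodule ℂ (H × H) where
  carrier := {p | ∃ u : ℕ → a.domain,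
    Tendsto (fun n => (u n : H)) atTop (𝓝 p.1) ∧
    (∃ C : ℝ, ∀ n, ‖a.toFun (u n) (u n)‖ ≤ C) ∧
    ∀ v : a.domain, Tendsto (fun n => a.toFun (u n) v) atTop (𝓝 (inner ℂ (v : H) p.2))}
  zero_mem' := ⟨fun _ => 0, by simp, ⟨0, by simp⟩, by simp⟩
  add_mem' := by
    rintro ⟨x, f⟩ ⟨y, g⟩ ⟨u, hux, ⟨C, hC⟩, huf⟩ ⟨v, hvy, ⟨D, hD⟩, hvg⟩
    obtain ⟨γ, θ, h⟩ := ha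
    have ht : 0 ≤ Real.tan θ := Real.tan_nonneg_of_nonneg_of_le_pi_div_two h.1 h.2.1.le
    have hlim : Tendsto (fun n => ((u n + v n : a.domain) : H)) atTop (𝓝 (x + y)) :=
      hux.add hvy
    obtain ⟨B, hB⟩ := hux.norm.bddAbove_range
    obtain ⟨B', hB'⟩ := hvy.norm.bddAbove_range
    obtain ⟨E, hE⟩ := hlim.norm.bddAbove_range
    refine ⟨fun n => u n + v n, hlim, ⟨(1 + Real.tan θ) * (2 * (C + |γ| * B ^ 2)
      + 2 * (D + |γ| * B' ^ 2)) + |γ| * E ^ 2, fun n => ?_⟩, fun w => ?_⟩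
    · have h1 : ‖(u n : H)‖ ≤ B := hB ⟨n, rfl⟩
      have h2 : ‖(v n : H)‖ ≤ B' := hB' ⟨n, rfl⟩
      have h3 : ‖((u n + v n : a.domain) : H)‖ ≤ E := hE ⟨n, rfl⟩
      refine (h.norm_apply_add_le (u n) (v n)).trans ?_
      have := hC n
      have := hD n
      gcongr
    · simp only [map_add, LinearMap.add_apply, Prod.mk_add_mk, inner_add_right]
      exact (huf w).add (hvg w)
  smul_mem' := by
    rintro c ⟨x, f⟩ ⟨u, hux, ⟨C, hC⟩, huf⟩
    refine ⟨fun n => c • u n, hux.const_smul c, ⟨‖c‖ * (‖c‖ * C), fun n => ?_⟩, fun w => ?_⟩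
    · simp only [map_smul, LinearMap.map_smulₛₗ, LinearMap.smul_apply, norm_smul, RCLike.norm_conj]
      have := hC n
      gcongr
    · simp only [map_smul, LinearMap.smul_apply, Prod.smul_mk, inner_smul_right, smul_eq_mul]
      exact (huf w).const_mul c

/-- The graph `{(u, f) ∈ D(𝔞) × H : 𝔞(u, v) = (f, v)_H for all v ∈ D(𝔞)}`, which is how the graph
associated with a closed sectorial form is usually described. -/
def variationalGraph (a : SesqForm H) : Submodule ℂ (H × H) where
  carrier := {p | ∃ u : a.domain, (u : H) = p.1 ∧
    ∀ v : a.domain, a.toFun u v = inner ℂ (v : H) p.2}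
  zero_mem' := ⟨0, by simp⟩
  add_mem' := by
    rintro ⟨x, f⟩ ⟨y, g⟩ ⟨u, hu, huf⟩ ⟨v, hv, hvg⟩
    refine ⟨u + v, by simp_all, fun w => ?_⟩
    simp only [map_add, LinearMap.add_apply, Prod.mk_add_mk, inner_add_right, huf, hvg]
  smul_mem' := by
    rintro c ⟨x, f⟩ ⟨u, hu, huf⟩
    refine ⟨c • u, by simp_all, fun w => ?_⟩
    simp only [map_smul, LinearMap.smul_apply, Prod.smul_mk, inner_smul_right, smul_eq_mul, huf]

end SesqForm

/-! Graphs in `H`, that is, subspaces of `H × H`. -/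

namespace LinGraph

variable {H : Type*} [NormedAddCommGroup H] [InnerProductSpace ℂ H]

/-- A graph is single-valued, or an operator, if `{y : (0, y) ∈ A} = {0}`. -/
def IsSingleValued (A : Submodule ℂ (H × H)) : Prop := ∀ y : H, ((0 : H), y) ∈ A → y = 0

/-- The graph `A + lam I = {(x, y + lam x) : (x, y) ∈ A}`. -/
def shift (A : Submodule ℂ (H × H)) (lam : ℂ) : Submodule ℂ (H × H) :=
  A.map ((LinearMap.fst ℂ H H).prod (LinearMap.snd ℂ H H + lam • LinearMap.fst ℂ H H))

/-- A graph is invertible if it is surjective, closed, and the reflected graph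
`{(y, x) : (x, y) ∈ A}` is single-valued. -/
structure IsInvertible (A : Submodule ℂ (H × H)) : Prop where
  surjective : ∀ y : H, ∃ x : H, (x, y) ∈ A
  closed : IsClosed (A : Set (H × H))
  injective : ∀ x : H, (x, (0 : H)) ∈ A → x = 0

/-- The inverse operator `A⁻¹ : H → H` of an invertible graph: `A⁻¹ y` is the (unique) `x` with
`(x, y) ∈ A`. -/
noncomputable def inverse (A : Submodule ℂ (H × H)) (hA : IsInvertible A) (y : H) : H :=
  Classical.choose (hA.surjective y)

/-- `A` is an `m`-sectorial graph with vertex `γ` and semi-angle `θ`: `0 ≤ θ < π / 2`,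
`(x, y)_H ∈ Σ_θ` for all `(x, y) ∈ A - γ I`, and `A - (γ - 1) I` is invertible. -/
def IsMSectorialWith (A : Submodule ℂ (H × H)) (γ θ : ℝ) : Prop :=
  0 ≤ θ ∧ θ < Real.pi / 2 ∧
    (∀ x y : H, (x, y) ∈ shift A (-(γ : ℂ)) → inner ℂ y x ∈ sector θ) ∧
    IsInvertible (shift A (-((γ : ℂ) - 1)))

/-- Convergence `A_n → A` in the strong resolvent sense, for `m`-sectorial graphs with vertex `0`:
for every `lam` in the open right half-plane, which is contained in the resolvent set of `-A_n` and
of `-A`, and for every `f ∈ H`, one has `(A_n + lam I)⁻¹ f → (A + lam I)⁻¹ f` in `H`. -/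
def StrongResolventTendsto (A : ℕ → Submodule ℂ (H × H)) (A' : Submodule ℂ (H × H)) : Prop :=
  ∀ lam : ℂ, 0 < lam.re →
    ∃ (hA : ∀ n, IsInvertible (shift (A n) lam)) (hA' : IsInvertible (shift A' lam)),
      ∀ f : H, Tendsto (fun n => inverse (shift (A n) lam) (hA n) f) atTop
        (𝓝 (inverse (shift A' lam) hA' f))

end LinGraph

/-! All the forms are placed in one Hilbert space, where the theorem becomes strong convergence of
the projections onto a decreasing sequence of closed subspaces. The real part of `b k` is a
semi-inner product on its domain. Completing gives a Hilbert space `K k`, a map `q k` into it and a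
bounded operator `B k` with (B_k q_k u, q_k v) = b_k(u, v) and Re (B_k x, x) = ‖x‖². The common
semi-angle bounds all the `B k` by one constant, so they form a bounded diagonal operator on ℓ²(K).
In E = H ⊕ ℓ²(K) let T = 0 ⊕ diag(B_k) and let J be the projection onto H.

The map d_n u = (u, (q_0 u, …, q_n u, 0, …)) is isometric for the form norm of 𝔞_n and carries 𝔞_n
to T. With W_n the closure of its range, A_n consists of all (Jξ, f) with ξ ∈ W_n and (Tξ, η) = (f,
Jη) for η ∈ W_n (`IsRealizedBy.realized_eq_assocGraph`). No closability is needed, since J may fail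
to be injective on W_n.

The W_n are not nested, but A_n is unchanged if W_n is enlarged to M_n, the vectors whose n-th
truncation lies in W_n (`IsElliptic.realized_eq_of_projection`), and the M_n decrease
(`truncClosure_antitone`). The resolvents of A_n come from compressing the coercive operator T +
λJ*J to M_n, so they converge to the one on M_∞ = ⋂ M_n (`tendsto_of_antitone_of_coercive`). Thus
A_∞ is the graph realized on M_∞. If every 𝔞_n is closed, M_∞ is exactly the image of D(𝔞_∞)
(`range_seriesEmbed_eq`), which gives (b). -/

/-! ### Coercive operators on closed subspaces -/

section Coercive

variable {E : Type*} [NormedAddCommGroup E] [InnerProductSpace ℂ E]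

/-- Lax–Milgram for the compression of a coercive operator to a closed subspace. -/
theorem exists_compression_solution {T : E →L[ℂ] E} {c : ℝ} (hc : 0 < c)
    (hT : ∀ x, c * ‖x‖ ^ 2 ≤ (inner ℂ x (T x)).re) (M : Submodule ℂ E)
    [M.HasOrthogonalProjection] [CompleteSpace M] :
    ∃ S : E →L[ℂ] E, ∀ g, S g ∈ M ∧ ∀ v ∈ M, inner ℂ v (T (S g)) = inner ℂ v g := by
  set TM : M →L[ℂ] M := M.orthogonalProjectionOnto ∘L T ∘L M.subtypeL with hTM
  have hin : ∀ x y : M, inner ℂ x (TM y) = inner ℂ (x : E) (T y) := fun x y => by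
    simp [hTM]
  have hunit : IsUnit TM := by
    refine ContinuousLinearMap.isUnit_of_forall_le_norm_inner_map TM
      (c := ⟨c, hc.le⟩) hc fun x => ?_
    rw [← inner_conj_symm, RCLike.norm_conj, hin]
    calc ‖x‖ ^ 2 * c = c * ‖(x : E)‖ ^ 2 := by rw [mul_comm]; rfl
      _ ≤ _ := (hT x).trans (Complex.re_le_norm _)
  obtain ⟨U, hU⟩ := hunit
  refine ⟨M.subtypeL ∘L (↑U⁻¹ : M →L[ℂ] M) ∘L M.orthogonalProjectionOnto,
    fun g => ⟨Submodule.coe_mem _, fun v hv => ?_⟩⟩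
  have h1 : TM ((↑U⁻¹ : M →L[ℂ] M) (M.orthogonalProjectionOnto g))
      = M.orthogonalProjectionOnto g := by
    rw [← hU]
    exact DFunLike.congr_fun U.mul_inv _
  have h2 := hin ⟨v, hv⟩ ((↑U⁻¹ : M →L[ℂ] M) (M.orthogonalProjectionOnto g))
  rw [h1] at h2
  simpa using h2.symm

theorem eq_of_coercive_of_forall_inner_eq {T : E →L[ℂ] E} {c : ℝ} (hc : 0 < c)
    (hT : ∀ x, c * ‖x‖ ^ 2 ≤ (inner ℂ x (T x)).re) {M : Submodule ℂ E} {x y : E}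
    (hx : x ∈ M) (hy : y ∈ M) (h : ∀ v ∈ M, inner ℂ v (T x) = inner ℂ v (T y)) : x = y := by
  have h1 := hT (x - y)
  rw [map_sub, inner_sub_right, h _ (sub_mem hx hy), sub_self, Complex.zero_re] at h1
  have h2 : ‖x - y‖ ^ 2 = 0 :=
    le_antisymm (nonpos_of_mul_nonpos_right h1 hc) (sq_nonneg _)
  exact sub_eq_zero.1 (norm_eq_zero.1 (pow_eq_zero_iff two_ne_zero |>.1 h2))

variable [CompleteSpace E]

/-- The orthogonal complements increase and their union is dense in the complement of the
intersection, so the known convergence for increasing sequences applies to the complementary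
projections. -/
theorem starProjection_tendsto_iInf_of_antitone {M : ℕ → Submodule ℂ E} (hM : Antitone M)
    [∀ n, (M n).HasOrthogonalProjection]
    [(⨅ n, M n).HasOrthogonalProjection] (x : E) :
    Tendsto (fun n => (M n).starProjection x) atTop (𝓝 ((⨅ n, M n).starProjection x)) := by
  have hmono : Monotone fun n => (M n)ᗮ := fun i j hij => Submodule.orthogonal_le (hM hij)
  have h := Submodule.starProjection_tendsto_closure_iSup (fun n => (M n)ᗮ) hmono x
  have e : (⨆ n, (M n)ᗮ).topologicalClosure = (⨅ n, M n)ᗮ := by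
    rw [← Submodule.orthogonal_orthogonal_eq_closure, ← Submodule.iInf_orthogonal]
    simp only [Submodule.orthogonal_orthogonal]
  simp only [e, Submodule.starProjection_orthogonal_val] at h
  simpa using (tendsto_const_nhds (x := x)).sub h

/-- Solutions of a coercive problem on a decreasing sequence of closed subspaces converge
to the solution on the intersection. -/
theorem tendsto_of_antitone_of_coercive {T : E →L[ℂ] E} {c : ℝ} (hc : 0 < c)
    (hT : ∀ x, c * ‖x‖ ^ 2 ≤ (inner ℂ x (T x)).re) {M : ℕ → Submodule ℂ E} (hM : Antitone M)
    (hcl : ∀ n, IsClosed (M n : Set E)) {g y : E} {x : ℕ → E} (hx : ∀ n, x n ∈ M n)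
    (hxg : ∀ n, ∀ v ∈ M n, inner ℂ v (T (x n)) = inner ℂ v g) (hy : y ∈ ⨅ n, M n)
    (hyg : ∀ v ∈ ⨅ n, M n, inner ℂ v (T y) = inner ℂ v g) :
    Tendsto x atTop (𝓝 y) := by
  have hcl' : IsClosed ((⨅ n, M n : Submodule ℂ E) : Set E) := by
    rw [Submodule.coe_iInf]; exact isClosed_iInter hcl
  have : ∀ n, CompleteSpace (M n) := fun n => (hcl n).completeSpace_coe
  have : CompleteSpace (⨅ n, M n : Submodule ℂ E) := hcl'.completeSpace_coe
  have hP := starProjection_tendsto_iInf_of_antitone hM (g - T y)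
  have h0 : (⨅ n, M n).starProjection (g - T y) = 0 := by
    refine (Submodule.starProjection_apply_eq_zero_iff _).2 ((Submodule.mem_orthogonal _ _).2
      fun v hv => ?_)
    rw [inner_sub_right, hyg v hv, sub_self]
  rw [h0] at hP
  -- A Céa-type estimate: y lies in every M_n, so x_n - y is an admissible test vector. Coercivity
  -- then bounds it by the part of the residual g - T y in M_n, which tends to zero.
  have hle : ∀ n, ‖x n - y‖ ≤ c⁻¹ * ‖(M n).starProjection (g - T y)‖ := fun n => by
    have hm : x n - y ∈ M n := sub_mem (hx n) ((Submodule.mem_iInf _).1 hy n)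
    have h1 := hT (x n - y)
    have h2 : inner ℂ (x n - y) (T (x n - y))
        = inner ℂ (x n - y) ((M n).starProjection (g - T y)) := by
      rw [← Submodule.inner_starProjection_left_eq_right,
        Submodule.starProjection_eq_self_iff.2 hm, map_sub, inner_sub_right, hxg n _ hm,
        inner_sub_right]
    rw [h2] at h1
    have h3 := h1.trans ((Complex.re_le_norm _).trans (norm_inner_le_norm _ _))
    rw [inv_mul_eq_div, le_div_iff₀ hc]
    rcases (norm_nonneg (x n - y)).eq_or_lt with h | h
    · rw [← h, zero_mul]; exact norm_nonneg _
    · refine le_of_mul_le_mul_left ?_ h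
      linarith
  rw [tendsto_iff_norm_sub_tendsto_zero]
  refine squeeze_zero (fun n => norm_nonneg _) hle ?_
  simpa using hP.norm.const_mul c⁻¹

end Coercive

/-! ### Graphs realized in an auxiliary Hilbert space -/

namespace LinGraph

variable {H : Type*} [NormedAddCommGroup H] [InnerProductSpace ℂ H]

theorem mem_shift {A : Submodule ℂ (H × H)} {lam : ℂ} {x y : H} :
    (x, y) ∈ shift A lam ↔ (x, y - lam • x) ∈ A := by
  simp only [shift, Submodule.mem_map, Prod.exists]
  constructor
  · rintro ⟨a, b, hab, h⟩
    obtain ⟨rfl, rfl⟩ := Prod.ext_iff.1 h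
    simpa using hab
  · intro h
    exact ⟨_, _, h, by simp⟩

theorem isInvertible_of_mem_iff {A : Submodule ℂ (H × H)} (R : H →L[ℂ] H)
    (h : ∀ x y, (x, y) ∈ A ↔ x = R y) : IsInvertible A where
  surjective y := ⟨R y, (h _ _).2 rfl⟩
  closed := by
    have : (A : Set (H × H)) = {p | p.1 = R p.2} := Set.ext fun p => h p.1 p.2
    rw [this]
    exact isClosed_eq continuous_fst (R.continuous.comp continuous_snd)
  injective x hx := by simpa using (h _ _).1 hx

theorem inverse_eq_of_mem_iff {A : Submodule ℂ (H × H)} {R : H →L[ℂ] H}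
    (h : ∀ x y, (x, y) ∈ A ↔ x = R y) (hA : IsInvertible A) (y : H) : inverse A hA y = R y :=
  (h _ _).1 (Classical.choose_spec (hA.surjective y))

/-- Maximality: a graph whose shift is surjective has no proper extension whose shift is injective.
This reduces each identification of graphs below to one inclusion. -/
theorem eq_of_le_of_shift {A B : Submodule ℂ (H × H)} (hAB : A ≤ B) {lam : ℂ}
    (hA : ∀ y, ∃ x, (x, y) ∈ shift A lam) (hB : ∀ x, (x, (0 : H)) ∈ shift B lam → x = 0) :
    A = B := by
  refine le_antisymm hAB ?_
  rintro ⟨x, y⟩ hxy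
  obtain ⟨x', hx'⟩ := hA (y + lam • x)
  rw [mem_shift] at hx'
  have h := B.sub_mem hxy (hAB hx')
  have hxx : x - x' = 0 := by
    refine hB _ (mem_shift.2 ?_)
    have e : (0 : H) - lam • (x - x') = y - (y + lam • x - lam • x') := by
      rw [smul_sub]; abel
    rw [e]
    exact h
  have : x = x' := sub_eq_zero.1 hxx
  subst this
  simpa using hx'

variable {E : Type*} [NormedAddCommGroup E] [InnerProductSpace ℂ E]

/-- The graph of all `(J ξ, f)` with `ξ ∈ M` and `(T ξ, η)_E = (f, J η)_H` for all `η ∈ M`. -/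
def realized (T : E →L[ℂ] E) (J : E →L[ℂ] H) (M : Submodule ℂ E) : Submodule ℂ (H × H) where
  carrier := {p | ∃ ξ ∈ M, J ξ = p.1 ∧ ∀ η ∈ M, inner ℂ η (T ξ) = inner ℂ (J η) p.2}
  zero_mem' := ⟨0, zero_mem _, by simp⟩
  add_mem' := by
    rintro ⟨x, f⟩ ⟨y, g⟩ ⟨ξ, hξ, h1, h2⟩ ⟨ζ, hζ, h3, h4⟩
    refine ⟨ξ + ζ, add_mem hξ hζ, by simp_all, fun η hη => ?_⟩
    simp only [map_add, inner_add_right, Prod.mk_add_mk, h2 η hη, h4 η hη]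
  smul_mem' := by
    rintro c ⟨x, f⟩ ⟨ξ, hξ, h1, h2⟩
    refine ⟨c • ξ, Submodule.smul_mem _ _ hξ, by simp_all, fun η hη => ?_⟩
    simp only [map_smul, inner_smul_right, Prod.smul_mk, h2 η hη]

theorem mem_realized {T : E →L[ℂ] E} {J : E →L[ℂ] H} {M : Submodule ℂ E} {x f : H} :
    (x, f) ∈ realized T J M ↔
      ∃ ξ ∈ M, J ξ = x ∧ ∀ η ∈ M, inner ℂ η (T ξ) = inner ℂ (J η) f := Iff.rfl

/-- `T` is accretive, and `‖x‖² = ‖J x‖² + Re (T x, x)`. -/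
structure IsElliptic (T : E →L[ℂ] E) (J : E →L[ℂ] H) : Prop where
  re_nonneg : ∀ x, 0 ≤ (inner ℂ x (T x)).re
  norm_sq_eq : ∀ x, ‖x‖ ^ 2 = ‖J x‖ ^ 2 + (inner ℂ x (T x)).re

variable {T : E →L[ℂ] E} {J : E →L[ℂ] H}

/-- If Jξ = 0, testing the equation with η = ξ gives Re (Tξ, ξ) = 0, hence ξ = 0 by the norm
identity. The right-hand side is then orthogonal to the dense subspace J M. -/
theorem IsElliptic.isSingleValued (h : IsElliptic T J) {M : Submodule ℂ E}
    (hd : Dense (M.map (J : E →ₗ[ℂ] H) : Set H)) : IsSingleValued (realized T J M) := by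
  rintro y ⟨ξ, hξ, hJ, hf⟩
  have h1 := h.norm_sq_eq ξ
  have hJ' : J ξ = 0 := hJ
  rw [hf ξ hξ, hJ', inner_zero_left, norm_zero] at h1
  have hξ0 : ξ = 0 := by
    have : ‖ξ‖ ^ 2 = 0 := by simpa using h1
    exact norm_eq_zero.1 (pow_eq_zero_iff two_ne_zero |>.1 this)
  subst hξ0
  refine Dense.eq_zero_of_mem_orthogonal hd ((Submodule.mem_orthogonal _ _).2 ?_)
  rintro _ ⟨η, hη, rfl⟩
  have := hf η hη
  simpa using this.symm

variable [CompleteSpace H] [CompleteSpace E]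

/-- The operator `T + lam J* J`. -/
noncomputable def shiftOp (T : E →L[ℂ] E) (J : E →L[ℂ] H) (lam : ℂ) : E →L[ℂ] E :=
  T + lam • (J.adjoint ∘L J)

theorem inner_shiftOp (T : E →L[ℂ] E) (J : E →L[ℂ] H) (lam : ℂ) (η ξ : E) :
    inner ℂ η (shiftOp T J lam ξ) = inner ℂ η (T ξ) + lam * inner ℂ (J η) (J ξ) := by
  simp [shiftOp, ContinuousLinearMap.adjoint_inner_right]

theorem mem_shift_realized {T : E →L[ℂ] E} {J : E →L[ℂ] H} {M : Submodule ℂ E} {lam : ℂ}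
    {x f : H} : (x, f) ∈ shift (realized T J M) lam ↔
      ∃ ξ ∈ M, J ξ = x ∧ ∀ η ∈ M, inner ℂ η (shiftOp T J lam ξ) = inner ℂ (J η) f := by
  rw [mem_shift, mem_realized]
  refine exists_congr fun ξ => and_congr_right fun _ => and_congr_right fun hx =>
    forall₂_congr fun η _ => ?_
  rw [inner_shiftOp, inner_sub_right, inner_smul_right, hx, eq_sub_iff_add_eq]

theorem IsElliptic.coercive (h : IsElliptic T J) {lam : ℂ} (hlam : 0 < lam.re) (x : E) :
    min 1 lam.re * ‖x‖ ^ 2 ≤ (inner ℂ x (shiftOp T J lam x)).re := by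
  rw [inner_shiftOp, inner_self_eq_norm_sq_to_K]
  have e : (lam * ((‖J x‖ : ℝ) : ℂ) ^ 2).re = lam.re * ‖J x‖ ^ 2 := by
    rw [← Complex.ofReal_pow, Complex.re_mul_ofReal]
  have h1 := h.re_nonneg x
  have h2 := (h.norm_sq_eq x).le
  have hm : 0 < min 1 lam.re := lt_min one_pos hlam
  calc min 1 lam.re * ‖x‖ ^ 2 ≤ min 1 lam.re * (‖J x‖ ^ 2 + (inner ℂ x (T x)).re) := by gcongr
    _ = min 1 lam.re * ‖J x‖ ^ 2 + min 1 lam.re * (inner ℂ x (T x)).re := by ring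
    _ ≤ lam.re * ‖J x‖ ^ 2 + 1 * (inner ℂ x (T x)).re := by
      gcongr
      · exact min_le_right _ _
      · exact min_le_left _ _
    _ = _ := by
      rw [Complex.add_re]
      erw [e]
      ring

/-- The resolvent factors as J S through the solution operator S. Keeping S itself allows
convergence to be proved in E before J is applied. -/
theorem IsElliptic.exists_solution (h : IsElliptic T J) {lam : ℂ} (hlam : 0 < lam.re)
    {M : Submodule ℂ E} (hM : IsClosed (M : Set E)) :
    ∃ S : H →L[ℂ] E, (∀ f, S f ∈ M ∧
      ∀ η ∈ M, inner ℂ η (shiftOp T J lam (S f)) = inner ℂ (J η) f) ∧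
      ∀ x f, (x, f) ∈ shift (realized T J M) lam ↔ x = (J ∘L S) f := by
  have : CompleteSpace M := hM.completeSpace_coe
  obtain ⟨S, hS⟩ := exists_compression_solution (lt_min one_pos hlam) (h.coercive hlam) M
  have key : ∀ f, S (J.adjoint f) ∈ M ∧
      ∀ η ∈ M, inner ℂ η (shiftOp T J lam (S (J.adjoint f))) = inner ℂ (J η) f := fun f =>
    ⟨(hS _).1, fun η hη => by
      rw [(hS _).2 η hη, ContinuousLinearMap.adjoint_inner_right]⟩
  refine ⟨S ∘L J.adjoint, key, fun x f => ?_⟩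
  rw [mem_shift_realized]
  constructor
  · rintro ⟨ξ, hξ, rfl, hξf⟩
    have := eq_of_coercive_of_forall_inner_eq (lt_min one_pos hlam) (h.coercive hlam) hξ
      (key f).1 fun v hv => by rw [hξf v hv, (key f).2 v hv]
    rw [this]; rfl
  · rintro rfl
    exact ⟨_, (key f).1, rfl, (key f).2⟩

theorem IsElliptic.isInvertible (h : IsElliptic T J) {lam : ℂ} (hlam : 0 < lam.re)
    {M : Submodule ℂ E} (hM : IsClosed (M : Set E)) :
    IsInvertible (shift (realized T J M) lam) := by
  obtain ⟨S, -, hS⟩ := h.exists_solution hlam hM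
  exact isInvertible_of_mem_iff _ hS

theorem IsElliptic.isMSectorialWith (h : IsElliptic T J) {θ : ℝ} (h0 : 0 ≤ θ)
    (hθ : θ < Real.pi / 2) (hT : ∀ x, inner ℂ x (T x) ∈ sector θ) {M : Submodule ℂ E}
    (hM : IsClosed (M : Set E)) : IsMSectorialWith (realized T J M) 0 θ := by
  refine ⟨h0, hθ, fun x y hxy => ?_, ?_⟩
  · rw [mem_shift] at hxy
    simp only [Complex.ofReal_zero, neg_zero, zero_smul, sub_zero] at hxy
    obtain ⟨ξ, hξ, rfl, hf⟩ := hxy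
    have h1 := hT ξ
    rw [hf ξ hξ] at h1
    rw [mem_sector_iff h0 hθ] at h1 ⊢
    -- The two orders of the inner product are conjugate, and the sector is symmetric under
    -- conjugation.
    have e : inner ℂ y (J ξ) = (starRingEnd ℂ) (inner ℂ (J ξ) y) := (inner_conj_symm _ _).symm
    rw [e, Complex.conj_re, Complex.conj_im, abs_neg]
    exact h1
  · exact h.isInvertible (by simp) hM

theorem IsElliptic.strongResolventTendsto (h : IsElliptic T J) {M : ℕ → Submodule ℂ E}
    (hM : Antitone M) (hcl : ∀ n, IsClosed (M n : Set E)) :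
    StrongResolventTendsto (fun n => realized T J (M n)) (realized T J (⨅ n, M n)) := by
  have hcl' : IsClosed ((⨅ n, M n : Submodule ℂ E) : Set E) := by
    rw [Submodule.coe_iInf]; exact isClosed_iInter hcl
  intro lam hlam
  choose S hS hSm using fun n => h.exists_solution hlam (hcl n)
  obtain ⟨S', hS', hSm'⟩ := h.exists_solution hlam hcl'
  refine ⟨fun n => h.isInvertible hlam (hcl n), h.isInvertible hlam hcl', fun f => ?_⟩
  simp only [inverse_eq_of_mem_iff (hSm _), inverse_eq_of_mem_iff hSm']
  refine (J.continuous.tendsto _).comp ?_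
  have hadj : ∀ η : E, inner ℂ (J η) f = inner ℂ η (J.adjoint f) := fun η =>
    (ContinuousLinearMap.adjoint_inner_right _ _ _).symm
  exact tendsto_of_antitone_of_coercive (g := J.adjoint f) (lt_min one_pos hlam)
    (h.coercive hlam) hM hcl (fun n => (hS n f).1)
    (fun n v hv => ((hS n f).2 v hv).trans (hadj v)) (hS' f).1
    (fun v hv => ((hS' f).2 v hv).trans (hadj v))

end LinGraph

/-! ### Weak convergence of bounded sequences -/

section WeakConvergence

variable {E : Type*} [NormedAddCommGroup E] [InnerProductSpace ℂ E]

theorem tendsto_inner_zero_of_mem_closure {y : ℕ → E} {C : ℝ} (hy : ∀ n, ‖y n‖ ≤ C) {s : Set E}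
    (hs : ∀ η ∈ s, Tendsto (fun n => inner ℂ η (y n)) atTop (𝓝 0)) {η : E} (hη : η ∈ closure s) :
    Tendsto (fun n => inner ℂ η (y n)) atTop (𝓝 0) := by
  have hC : 0 ≤ C := (norm_nonneg _).trans (hy 0)
  rw [Metric.tendsto_atTop]
  intro ε hε
  -- Dividing by C + 1 rather than C covers the case C = 0.
  obtain ⟨η', hη', hd⟩ := Metric.mem_closure_iff.1 hη (ε / 2 / (C + 1)) (by positivity)
  obtain ⟨N, hN⟩ := Metric.tendsto_atTop.1 (hs η' hη') (ε / 2) (half_pos hε)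
  refine ⟨N, fun n hn => ?_⟩
  have h1 := hN n hn
  rw [dist_zero_right] at h1 ⊢
  rw [dist_eq_norm, lt_div_iff₀ (by positivity)] at hd
  have h2 : ‖inner ℂ (η - η') (y n)‖ ≤ ‖η - η'‖ * (C + 1) :=
    (norm_inner_le_norm _ _).trans
      (mul_le_mul_of_nonneg_left ((hy n).trans (by linarith)) (norm_nonneg _))
  have h3 := norm_add_le (inner ℂ (η - η') (y n)) (inner ℂ η' (y n))
  rw [← inner_add_left, sub_add_cancel] at h3
  linarith

end WeakConvergence

namespace LinGraph

variable {H : Type*} [NormedAddCommGroup H] [InnerProductSpace ℂ H] [CompleteSpace H]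
variable {E : Type*} [NormedAddCommGroup E] [InnerProductSpace ℂ E] [CompleteSpace E]
variable {T : E →L[ℂ] E} {J : E →L[ℂ] H}

/-- Enlarging `W` to `M` does not change the realized graph if a map `P` of `M` into `W` is
compatible with `J` and with `T`. -/
theorem IsElliptic.realized_eq_of_projection (h : IsElliptic T J) {W M : Submodule ℂ E}
    (hW : IsClosed (W : Set E)) (hM : IsClosed (M : Set E)) (hWM : W ≤ M) {P : E → E}
    (hP : ∀ ξ ∈ M, P ξ ∈ W) (hJ : ∀ ξ, J (P ξ) = J ξ)
    (hT : ∀ ξ ∈ W, ∀ η, inner ℂ η (T ξ) = inner ℂ (P η) (T ξ)) :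
    realized T J W = realized T J M := by
  refine eq_of_le_of_shift (lam := 1) ?_ (h.isInvertible (by simp) hW).surjective
    (h.isInvertible (by simp) hM).injective
  rintro ⟨x, f⟩ ⟨ξ, hξ, hx, hf⟩
  -- A test vector η in M may be replaced by P η in W, since neither side of the equation changes.
  exact ⟨ξ, hWM hξ, hx, fun η hη => by rw [hT ξ hξ, hf _ (hP η hη), hJ]⟩

end LinGraph

/-! ### Forms realized by an operator, and their associated graphs -/

namespace SesqForm

open LinGraph

variable {H : Type*} [NormedAddCommGroup H] [InnerProductSpace ℂ H]
variable {E : Type*} [NormedAddCommGroup E] [InnerProductSpace ℂ E]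

/-- The form `a` is `(u, v) ↦ (T (d u), d v)_E`, and `J` recovers `u` from `d u`. -/
structure IsRealizedBy (a : SesqForm H) (T : E →L[ℂ] E) (J : E →L[ℂ] H)
    (d : a.domain →ₗ[ℂ] E) : Prop where
  map_eq : ∀ u, J (d u) = u
  inner_eq : ∀ u v, inner ℂ (d v) (T (d u)) = a.toFun u v

variable {a : SesqForm H} {T : E →L[ℂ] E} {J : E →L[ℂ] H} {d : a.domain →ₗ[ℂ] E}

theorem realized_range_eq_variationalGraph (hd : a.IsRealizedBy T J d) :
    realized T J (LinearMap.range d) = a.variationalGraph := by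
  ext ⟨x, f⟩
  constructor
  · rintro ⟨_, ⟨u, rfl⟩, hx, hf⟩
    exact ⟨u, (hd.map_eq u).symm.trans hx, fun v => by
      rw [← hd.inner_eq, hf _ ⟨v, rfl⟩, hd.map_eq]⟩
  · rintro ⟨u, hx, hf⟩
    refine ⟨_, ⟨u, rfl⟩, (hd.map_eq u).trans hx, ?_⟩
    rintro _ ⟨v, rfl⟩
    rw [hd.inner_eq, hd.map_eq, hf]

theorem IsRealizedBy.norm_sq_eq (hd : a.IsRealizedBy T J d) (h : IsElliptic T J) (u : a.domain) :
    ‖d u‖ ^ 2 = ‖(u : H)‖ ^ 2 + (a.toFun u u).re := by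
  rw [h.norm_sq_eq, hd.map_eq, hd.inner_eq]

theorem IsRealizedBy.formNorm_eq (hd : a.IsRealizedBy T J d) (h : IsElliptic T J) (u : a.domain) :
    a.formNorm 0 u = ‖d u‖ := by
  rw [formNorm, sub_zero, one_mul, add_comm, ← hd.norm_sq_eq h, Real.sqrt_sq (norm_nonneg _)]

/-- Approximating ξ in norm by vectors d(u_n) gives all three defining properties of the sequence,
by continuity of J and T. -/
theorem IsRealizedBy.realized_le_assocGraph (hd : a.IsRealizedBy T J d) (ha : a.IsSectorial) :
    realized T J (LinearMap.range d).topologicalClosure ≤ a.assocGraph ha := by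
  rintro ⟨x, f⟩ ⟨ξ, hξ, hx, hf⟩
  obtain ⟨y, hy, hyξ⟩ := mem_closure_iff_seq_limit.1 hξ
  choose u hu using hy
  obtain rfl : (fun n => d (u n)) = y := funext hu
  refine ⟨u, ?_, ?_, fun v => ?_⟩
  · have := (J.continuous.tendsto ξ).comp hyξ
    simpa only [Function.comp_def, hd.map_eq, hx] using this
  · have hlim : Tendsto (fun n => inner ℂ (d (u n)) (T (d (u n)))) atTop (𝓝 (inner ℂ ξ (T ξ))) :=
      hyξ.inner ((T.continuous.tendsto ξ).comp hyξ)
    obtain ⟨C, hC⟩ := hlim.norm.bddAbove_range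
    refine ⟨C, fun n => ?_⟩
    rw [← hd.inner_eq]
    exact hC ⟨n, rfl⟩
  · have hlim : Tendsto (fun n => inner ℂ (d v) (T (d (u n)))) atTop (𝓝 (inner ℂ (d v) (T ξ))) :=
      tendsto_const_nhds.inner ((T.continuous.tendsto ξ).comp hyξ)
    rw [hf _ (Submodule.le_topologicalClosure _ ⟨v, rfl⟩), hd.map_eq] at hlim
    simpa only [hd.inner_eq] using hlim

variable [CompleteSpace E]

/-- The map d is isometric for the form norm, and E is complete. -/
theorem IsRealizedBy.isClosedWith_iff (hd : a.IsRealizedBy T J d) (h : IsElliptic T J) :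
    a.IsClosedWith 0 ↔ IsClosed (LinearMap.range d : Set E) := by
  simp only [IsClosedWith, hd.formNorm_eq h, map_sub]
  constructor
  · intro hcl
    refine IsSeqClosed.isClosed fun x ξ hx hξ => ?_
    choose u hu using hx
    obtain ⟨w, hw⟩ := hcl u fun ε hε => by
      obtain ⟨N, hN⟩ := Metric.cauchySeq_iff.1 hξ.cauchySeq ε hε
      exact ⟨N, fun m hm n hn => by
        rw [hu, hu, ← dist_eq_norm]; exact hN m hm n hn⟩
    refine ⟨w, tendsto_nhds_unique (tendsto_iff_norm_sub_tendsto_zero.2 hw) ?_⟩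
    simpa only [hu] using hξ
  · intro hcl u hu
    have hc : CauchySeq fun n => d (u n) := Metric.cauchySeq_iff.2 fun ε hε => by
      simpa only [dist_eq_norm] using hu ε hε
    obtain ⟨ξ, hξ⟩ := cauchySeq_tendsto_of_complete hc
    obtain ⟨w, rfl⟩ := hcl.mem_of_tendsto hξ (Eventually.of_forall fun n => ⟨u n, rfl⟩)
    exact ⟨w, tendsto_iff_norm_sub_tendsto_zero.1 hξ⟩

theorem IsRealizedBy.topologicalClosure_range (hd : a.IsRealizedBy T J d) (h : IsElliptic T J)
    (hcl : a.IsClosedWith 0) : (LinearMap.range d).topologicalClosure = LinearMap.range d :=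
  ((hd.isClosedWith_iff h).1 hcl).submodule_topologicalClosure_eq

variable [CompleteSpace H]

/-- A duality argument avoids extracting weak limits. With T₁ = T + J*J, boundedness makes (T₁ d
u_n, η) tend to 0 for all η in the closed range W. Solving the adjoint problem in W with datum J*x
gives an η for which this quantity is (u_n, x), whose limit is ‖x‖². -/
theorem IsRealizedBy.eq_zero_of_mem_shift_assocGraph (hd : a.IsRealizedBy T J d)
    (h : IsElliptic T J) (ha : a.IsSectorial) {x : H}
    (hx : (x, (0 : H)) ∈ shift (a.assocGraph ha) 1) : x = 0 := by
  rw [mem_shift, one_smul, zero_sub] at hx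
  obtain ⟨u, hux, ⟨C, hC⟩, huf⟩ := hx
  set W := (LinearMap.range d).topologicalClosure with hW
  have hcl : IsClosed (W : Set E) := Submodule.isClosed_topologicalClosure _
  have : CompleteSpace W := hcl.completeSpace_coe
  obtain ⟨B, hB⟩ := hux.norm.bddAbove_range
  have hbd : ∀ n, ‖shiftOp T J 1 (d (u n))‖ ≤ ‖shiftOp T J 1‖ * √(B ^ 2 + C) := fun n => by
    refine (shiftOp T J 1).le_opNorm_of_le (Real.le_sqrt_of_sq_le ?_)
    rw [hd.norm_sq_eq h]
    have h1 : ‖(u n : H)‖ ≤ B := hB ⟨n, rfl⟩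
    have h2 := (Complex.re_le_norm _).trans (hC n)
    gcongr
  have hweak : ∀ η ∈ W,
      Tendsto (fun n => inner ℂ η (shiftOp T J 1 (d (u n)))) atTop (𝓝 0) := fun η hη => by
    refine tendsto_inner_zero_of_mem_closure hbd (s := LinearMap.range d) ?_ hη
    rintro _ ⟨v, rfl⟩
    simp only [inner_shiftOp, hd.inner_eq, hd.map_eq, one_mul]
    have h1 := (huf v).add ((tendsto_const_nhds (x := (v : H))).inner (𝕜 := ℂ) hux)
    simpa using h1
  have hadj : ∀ y : E, min 1 (1 : ℂ).re * ‖y‖ ^ 2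
      ≤ (inner ℂ y ((shiftOp T J 1).adjoint y)).re := fun y => by
    rw [ContinuousLinearMap.adjoint_inner_right]
    refine (h.coercive (lam := 1) (by simp) y).trans_eq ?_
    exact inner_re_symm (𝕜 := ℂ) _ _
  obtain ⟨S, hS⟩ := exists_compression_solution (by simp) hadj W
  obtain ⟨hmem, hsol⟩ := hS (J.adjoint x)
  have hlim := hweak _ hmem
  have e : ∀ n, inner ℂ (S (J.adjoint x)) (shiftOp T J 1 (d (u n))) = inner ℂ x (u n : H) :=
    fun n => by
      have h1 := hsol _ (Submodule.le_topologicalClosure _ ⟨u n, rfl⟩)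
      rw [ContinuousLinearMap.adjoint_inner_right, ContinuousLinearMap.adjoint_inner_right,
        hd.map_eq] at h1
      rw [← inner_conj_symm, h1, inner_conj_symm]
  simp only [e] at hlim
  exact inner_self_eq_zero.1
    (tendsto_nhds_unique ((tendsto_const_nhds (x := x)).inner (𝕜 := ℂ) hux) hlim)

theorem IsRealizedBy.realized_eq_assocGraph (hd : a.IsRealizedBy T J d) (h : IsElliptic T J)
    (ha : a.IsSectorial) :
    realized T J (LinearMap.range d).topologicalClosure = a.assocGraph ha :=
  eq_of_le_of_shift (lam := 1) (hd.realized_le_assocGraph ha)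
    (h.isInvertible (by simp) (Submodule.isClosed_topologicalClosure _)).surjective
    fun _ => hd.eq_zero_of_mem_shift_assocGraph h ha

theorem IsRealizedBy.assocGraph_eq_variationalGraph (hd : a.IsRealizedBy T J d)
    (h : IsElliptic T J) (ha : a.IsSectorial) (hcl : a.IsClosedWith 0) :
    a.assocGraph ha = a.variationalGraph := by
  rw [← hd.realized_eq_assocGraph h, hd.topologicalClosure_range h hcl,
    realized_range_eq_variationalGraph hd]

end SesqForm

/-! ### The Hilbert space of a sectorial form -/

section SectorialHilbertSpace

/-- Polarization and the parallelogram law bound |t(u, v)| by C(‖u‖² + ‖v‖²). Replacing v by r v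
gives a quadratic in r that is nonnegative, and its discriminant yields the product bound without
dividing by a seminorm that may vanish. -/
theorem norm_apply_le_of_norm_apply_self_le {V : Type*} [SeminormedAddCommGroup V]
    [InnerProductSpace ℂ V] {t : V →ₗ[ℂ] V →ₗ⋆[ℂ] ℂ} {C : ℝ} (hC0 : 0 ≤ C)
    (hC : ∀ u, ‖t u u‖ ≤ C * ‖u‖ ^ 2) (u v : V) : ‖t u v‖ ≤ 2 * C * ‖u‖ * ‖v‖ := by
  have hpol : ∀ u v, ‖t u v‖ ≤ C * (‖u‖ ^ 2 + ‖v‖ ^ 2) := fun u v => by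
    have h1 : (4 : ℂ) * t u v = t (u + v) (u + v) - t (u - v) (u - v)
        + Complex.I * t (u + Complex.I • v) (u + Complex.I • v)
        - Complex.I * t (u - Complex.I • v) (u - Complex.I • v) := by
      simp only [map_add, map_sub, map_smul, LinearMap.map_smulₛₗ, LinearMap.add_apply,
        LinearMap.sub_apply, LinearMap.smul_apply, smul_eq_mul, Complex.conj_I]
      ring_nf
      simp only [Complex.I_sq]
      ring
    have h2 := congrArg norm h1
    rw [norm_mul, Complex.norm_ofNat] at h2
    have h3 : ‖t (u + v) (u + v) - t (u - v) (u - v)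
        + Complex.I * t (u + Complex.I • v) (u + Complex.I • v)
        - Complex.I * t (u - Complex.I • v) (u - Complex.I • v)‖ ≤
        ‖t (u + v) (u + v)‖ + ‖t (u - v) (u - v)‖ + ‖t (u + Complex.I • v) (u + Complex.I • v)‖
        + ‖t (u - Complex.I • v) (u - Complex.I • v)‖ := by
      refine (norm_sub_le _ _).trans (add_le_add ((norm_add_le _ _).trans
        (add_le_add (norm_sub_le _ _) ?_)) ?_) <;> simp
    have h4 := parallelogram_law_with_norm ℂ u v
    have h5 := parallelogram_law_with_norm ℂ u (Complex.I • v)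
    rw [norm_smul, Complex.norm_I, one_mul] at h5
    have e : C * ‖u + v‖ ^ 2 + C * ‖u - v‖ ^ 2 + C * ‖u + Complex.I • v‖ ^ 2
        + C * ‖u - Complex.I • v‖ ^ 2 = 4 * (C * (‖u‖ ^ 2 + ‖v‖ ^ 2)) := by
      linear_combination C * h4 + C * h5
    linarith [hC (u + v), hC (u - v), hC (u + Complex.I • v), hC (u - Complex.I • v)]
  have hquad : ∀ r : ℝ,
      0 ≤ C * ‖v‖ ^ 2 * (r * r) + -‖t u v‖ * r + C * ‖u‖ ^ 2 := fun r => by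
    have h := hpol u ((r : ℂ) • v)
    rw [LinearMap.map_smulₛₗ, norm_smul, norm_smul, RCLike.norm_conj, Complex.norm_real,
      Real.norm_eq_abs, mul_pow, sq_abs] at h
    have := mul_le_mul_of_nonneg_right (le_abs_self r) (norm_nonneg (t u v))
    linarith
  have hdisc := discrim_le_zero hquad
  rw [discrim] at hdisc
  refine le_of_sq_le_sq ?_ (by positivity)
  linarith

variable {V : Type*} [SeminormedAddCommGroup V] [InnerProductSpace ℂ V]

open UniformSpace (Completion)

/-- Riesz representation on the completion. The functional is the conjugate of t(u, ·), because t is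
conjugate-linear in its second variable. -/
theorem exists_inner_coe_eq {t : V →ₗ[ℂ] V →ₗ⋆[ℂ] ℂ} {C : ℝ} (hC0 : 0 ≤ C)
    (hC : ∀ u v, ‖t u v‖ ≤ C * ‖u‖ * ‖v‖) (u : V) :
    ∃ w : Completion V, ‖w‖ ≤ C * ‖u‖ ∧ ∀ v : V, inner ℂ (v : Completion V) w = t u v := by
  let g : V →L[ℂ] ℂ := LinearMap.mkContinuous
    { toFun := fun v => (starRingEnd ℂ) (t u v)
      map_add' := fun v w => by simp
      map_smul' := fun c v => by simp } (C * ‖u‖) fun v => by simpa using hC u v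
  have hg : ‖g‖ ≤ C * ‖u‖ := LinearMap.mkContinuous_norm_le _ (by positivity) _
  let e : V →L[ℂ] Completion V := Completion.toComplL
  have hd : DenseRange e := Completion.denseRange_coe
  have hge : ∀ v : V, g.extend e (v : Completion V) = g v :=
    fun v => g.extend_eq hd (Completion.isUniformInducing_coe V) v
  refine ⟨(InnerProductSpace.toDual ℂ _).symm (g.extend e), ?_, fun v => ?_⟩
  · rw [LinearIsometryEquiv.norm_map]
    refine ContinuousLinearMap.opNorm_le_bound _ (by positivity) fun x => ?_
    induction x using Completion.induction_on with
    | hp => exact isClosed_le (by fun_prop) (by fun_prop)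
    | ih v => rw [hge, Completion.norm_coe]; exact g.le_of_opNorm_le hg v
  · rw [← inner_conj_symm, InnerProductSpace.toDual_symm_apply]
    rw [hge]
    exact Complex.conj_conj _

/-- A bounded sesquilinear form on a pre-Hilbert space is given by a bounded operator on the
completion. -/
theorem exists_completion_operator {t : V →ₗ[ℂ] V →ₗ⋆[ℂ] ℂ} {C : ℝ} (hC0 : 0 ≤ C)
    (hC : ∀ u v, ‖t u v‖ ≤ C * ‖u‖ * ‖v‖) :
    ∃ B : Completion V →L[ℂ] Completion V, (∀ x, ‖B x‖ ≤ C * ‖x‖) ∧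
      ∀ u v : V, inner ℂ (v : Completion V) (B u) = t u v := by
  choose w hw hwt using exists_inner_coe_eq hC0 hC
  -- Testing on the dense image of V determines a vector, so the separately chosen representatives
  -- depend linearly on u.
  have huniq : ∀ x y : Completion V,
      (∀ v : V, inner ℂ (v : Completion V) x = inner ℂ (v : Completion V) y) → x = y :=
    fun x y hxy => by
      refine ext_inner_left ℂ fun z => ?_
      induction z using Completion.induction_on with
      | hp => exact isClosed_eq (by fun_prop) (by fun_prop)
      | ih v => exact hxy v
  let L : V →L[ℂ] Completion V := LinearMap.mkContinuous
    { toFun := w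
      map_add' := fun u u' => huniq _ _ fun v => by simp [inner_add_right, hwt]
      map_smul' := fun c u => huniq _ _ fun v => by simp [inner_smul_right, hwt] } C hw
  let e : V →L[ℂ] Completion V := Completion.toComplL
  have hd : DenseRange e := Completion.denseRange_coe
  have hB : ∀ u : V, L.extend e (u : Completion V) = w u :=
    fun u => L.extend_eq hd (Completion.isUniformInducing_coe V) u
  refine ⟨L.extend e, fun x => ?_, fun u v => by rw [hB, hwt]⟩
  induction x using Completion.induction_on with
  | hp => exact isClosed_le (by fun_prop) (by fun_prop)
  | ih u => rw [hB, Completion.norm_coe]; exact hw u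

end SectorialHilbertSpace

universe u

/-- The Hilbert space on which the real part of a sectorial form is the inner product. -/
theorem exists_hilbertSpace_of_sectorial {V : Type u} [AddCommGroup V] [Module ℂ V]
    (t : V →ₗ[ℂ] V →ₗ⋆[ℂ] ℂ) {τ : ℝ} (hτ : 0 ≤ τ) (hpos : ∀ u, 0 ≤ (t u u).re)
    (him : ∀ u, |(t u u).im| ≤ τ * (t u u).re) :
    ∃ (K : Type u) (_ : NormedAddCommGroup K) (_ : InnerProductSpace ℂ K) (_ : CompleteSpace K)
      (q : V →ₗ[ℂ] K) (B : K →L[ℂ] K), (∀ x, ‖B x‖ ≤ 2 * (1 + τ) * ‖x‖) ∧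
      (∀ x, (inner ℂ x (B x)).re = ‖x‖ ^ 2) ∧ (∀ x, |(inner ℂ x (B x)).im| ≤ τ * ‖x‖ ^ 2) ∧
      ∀ u v, inner ℂ (q v) (B (q u)) = t u v := by
  -- The Hermitian part of t, with the arguments exchanged because `inner` is conjugate-linear in
  -- the first variable. It may be degenerate; the completion identifies vectors at distance zero.
  let core : PreInnerProductSpace.Core ℂ V :=
    { inner := fun u v => (1 / 2 : ℂ) * (t v u + (starRingEnd ℂ) (t u v))
      conj_inner_symm := fun u v => by simp [add_comm, Complex.conj_ofNat]
      re_inner_nonneg := fun u => by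
        have : (1 / 2 : ℂ) * (t u u + (starRingEnd ℂ) (t u u)) = ((t u u).re : ℂ) := by
          rw [Complex.add_conj]; push_cast; ring
        change 0 ≤ ((1 / 2 : ℂ) * (t u u + (starRingEnd ℂ) (t u u))).re
        rw [this]
        exact hpos u
      add_left := fun u v w => by simp; ring
      smul_left := fun u v r => by simp; ring }
  let _ : SeminormedAddCommGroup V := InnerProductSpace.Core.toSeminormedAddCommGroup (c := core)
  let _ : InnerProductSpace ℂ V := InnerProductSpace.ofCore core
  have hnorm : ∀ u : V, ‖u‖ ^ 2 = (t u u).re := fun u => by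
    have h1 : ‖u‖ ^ 2 = (inner ℂ u u).re :=
      norm_sq_eq_re_inner (𝕜 := ℂ) u
    have h2 : inner ℂ u u = (1 / 2 : ℂ) * (t u u + (starRingEnd ℂ) (t u u)) := rfl
    rw [h1, h2, Complex.add_conj]
    simp
  have hself : ∀ u, ‖t u u‖ ≤ (1 + τ) * ‖u‖ ^ 2 := fun u => by
    have h1 := Complex.norm_le_abs_re_add_abs_im (t u u)
    rw [abs_of_nonneg (hpos u)] at h1
    rw [hnorm]
    linarith [him u]
  obtain ⟨B, hB, hBt⟩ := exists_completion_operator (C := 2 * (1 + τ)) (by positivity)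
    (norm_apply_le_of_norm_apply_self_le (by positivity) hself)
  refine ⟨UniformSpace.Completion V, inferInstance, inferInstance, inferInstance,
    (UniformSpace.Completion.toComplL : V →L[ℂ] UniformSpace.Completion V), B, hB,
    fun x => ?_, fun x => ?_, hBt⟩
  · induction x using UniformSpace.Completion.induction_on with
    | hp => exact isClosed_eq (by fun_prop) (by fun_prop)
    | ih u => rw [hBt, UniformSpace.Completion.norm_coe, hnorm]
  · induction x using UniformSpace.Completion.induction_on with
    | hp => exact isClosed_le (by fun_prop) (by fun_prop)
    | ih u => rw [hBt, UniformSpace.Completion.norm_coe, hnorm]; exact him u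

/-! ### Diagonal operators on a Hilbert sum -/

section HilbertSum

variable {K : ℕ → Type*} [∀ k, NormedAddCommGroup (K k)]

theorem memℓp_two_of_summable {x : ∀ k, K k} (hx : Summable fun k => ‖x k‖ ^ 2) : Memℓp x 2 :=
  memℓp_gen (by simpa using hx)

theorem hilbertSum_ext {H : Type*} {x y : WithLp 2 (H × lp K 2)} (h1 : x.fst = y.fst)
    (h2 : ∀ k, x.snd k = y.snd k) : x = y :=
  WithLp.ofLp_injective 2 (Prod.ext h1 (lp.ext (funext h2)))

variable [∀ k, InnerProductSpace ℂ (K k)]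

theorem hasSum_norm_sq_lp (x : lp K 2) : HasSum (fun k => ‖x k‖ ^ 2) (‖x‖ ^ 2) := by
  simpa [← Complex.ofReal_pow] using Complex.hasSum_re (lp.hasSum_inner (𝕜 := ℂ) x x)

/-- The operator on a Hilbert sum acting as `B k` on the `k`-th summand. -/
noncomputable def diagonalOp (B : ∀ k, K k →L[ℂ] K k) (C : ℝ)
    (hB : ∀ k x, ‖B k x‖ ≤ C * ‖x‖) : lp K 2 →L[ℂ] lp K 2 :=
  have hsq : ∀ (x : lp K 2) k, ‖B k (x k)‖ ^ 2 ≤ C ^ 2 * ‖x k‖ ^ 2 := fun x k => by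
    rw [← mul_pow]; exact pow_le_pow_left₀ (norm_nonneg _) (hB k _) 2
  have hmem : ∀ x : lp K 2, Memℓp (fun k => B k (x k)) 2 := fun x =>
    memℓp_two_of_summable (Summable.of_nonneg_of_le (fun k => sq_nonneg _) (hsq x)
      ((hasSum_norm_sq_lp x).summable.mul_left _))
  LinearMap.mkContinuous
    { toFun := fun x => ⟨fun k => B k (x k), hmem x⟩
      map_add' := fun x y => by ext k; exact map_add (B k) _ _
      map_smul' := fun c x => by ext k; exact map_smul (B k) _ _ } |C| fun x => by
    refine le_of_sq_le_sq ?_ (by positivity)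
    rw [mul_pow, sq_abs]
    exact hasSum_le (hsq x) (hasSum_norm_sq_lp (⟨fun k => B k (x k), hmem x⟩ : lp K 2))
      ((hasSum_norm_sq_lp x).mul_left _)

@[simp]
theorem diagonalOp_apply (B : ∀ k, K k →L[ℂ] K k) (C : ℝ)
    (hB : ∀ k x, ‖B k x‖ ≤ C * ‖x‖) (x : lp K 2) (k : ℕ) : diagonalOp B C hB x k = B k (x k) :=
  rfl

variable (H : Type*) [NormedAddCommGroup H] [InnerProductSpace ℂ H]

/-- The operator `0 ⊕ D` on `H ⊕ ℓ²(K)`. -/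
noncomputable def sumOp (D : lp K 2 →L[ℂ] lp K 2) :
    WithLp 2 (H × lp K 2) →L[ℂ] WithLp 2 (H × lp K 2) :=
  (WithLp.prodContinuousLinearEquiv 2 ℂ H (lp K 2)).symm.toContinuousLinearMap ∘L
    ((0 : WithLp 2 (H × lp K 2) →L[ℂ] H).prod (D ∘L WithLp.sndL 2 ℂ H (lp K 2)))

theorem inner_sumOp (D : lp K 2 →L[ℂ] lp K 2) (x y : WithLp 2 (H × lp K 2)) :
    inner ℂ x (sumOp H D y) = inner ℂ x.snd (D y.snd) := by
  have h1 : (sumOp H D y).fst = 0 := rfl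
  have h2 : (sumOp H D y).snd = D y.snd := rfl
  change inner ℂ x.fst (sumOp H D y).fst + inner ℂ x.snd (sumOp H D y).snd = _
  rw [h1, h2, inner_zero_right, zero_add]

/-- The truncation `(x, (y_k)_k) ↦ (x, (y_0, …, y_n, 0, …))`. -/
noncomputable def truncation (n : ℕ) : WithLp 2 (H × lp K 2) →L[ℂ] WithLp 2 (H × lp K 2) :=
  (WithLp.prodContinuousLinearEquiv 2 ℂ H (lp K 2)).symm.toContinuousLinearMap ∘L
    ((WithLp.fstL 2 ℂ H (lp K 2)).prod (diagonalOp
      (fun k => if k ≤ n then ContinuousLinearMap.id ℂ (K k) else 0) 1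
      (fun k x => by split_ifs <;> simp) ∘L WithLp.sndL 2 ℂ H (lp K 2)))

variable {H}

theorem truncation_snd (n : ℕ) (x : WithLp 2 (H × lp K 2)) (k : ℕ) :
    (truncation H n x).snd k = if k ≤ n then x.snd k else 0 := by
  change (if k ≤ n then ContinuousLinearMap.id ℂ (K k) else 0) (x.snd k) = _
  split_ifs <;> rfl

/-- A diagonal operator keeps the components beyond n equal to zero, so those of η do not matter. -/
theorem inner_diagonal_truncation {B : ∀ k, K k →L[ℂ] K k} {C : ℝ}
    (hB : ∀ k x, ‖B k x‖ ≤ C * ‖x‖) {n : ℕ} {ξ : WithLp 2 (H × lp K 2)}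
    (hξ : truncation H n ξ = ξ) (η : WithLp 2 (H × lp K 2)) :
    inner ℂ η (sumOp H (diagonalOp B C hB) ξ)
      = inner ℂ (truncation H n η) (sumOp H (diagonalOp B C hB) ξ) := by
  simp only [inner_sumOp, lp.inner_eq_tsum]
  refine tsum_congr fun k => ?_
  rw [truncation_snd, diagonalOp_apply]
  split_ifs with h
  · rfl
  · rw [← hξ, truncation_snd, if_neg h, map_zero, inner_zero_right, inner_zero_left]

theorem inner_diagonal_mem {B : ∀ k, K k →L[ℂ] K k} {C τ : ℝ}
    (hB : ∀ k x, ‖B k x‖ ≤ C * ‖x‖) (hre : ∀ k x, (inner ℂ x (B k x)).re = ‖x‖ ^ 2)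
    (him : ∀ k x, |(inner ℂ x (B k x)).im| ≤ τ * ‖x‖ ^ 2) (x : WithLp 2 (H × lp K 2)) :
    (inner ℂ x (sumOp H (diagonalOp B C hB) x)).re = ‖x.snd‖ ^ 2 ∧
      |(inner ℂ x (sumOp H (diagonalOp B C hB) x)).im| ≤ τ * ‖x.snd‖ ^ 2 := by
  rw [inner_sumOp]
  have h := lp.hasSum_inner (𝕜 := ℂ) x.snd (diagonalOp B C hB x.snd)
  have h1 := Complex.hasSum_re h
  have h2 := Complex.hasSum_im h
  have h3 := hasSum_norm_sq_lp x.snd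
  simp only [diagonalOp_apply, hre] at h1 h2
  refine ⟨h1.unique h3, abs_le.2 ⟨?_, ?_⟩⟩
  · refine neg_le.1 (hasSum_le (fun k => ?_) h2.neg (h3.mul_left τ))
    exact neg_le.1 (abs_le.1 (him k _)).1
  · exact hasSum_le (fun k => (abs_le.1 (him k _)).2) h2 (h3.mul_left τ)

theorem isElliptic_diagonal {B : ∀ k, K k →L[ℂ] K k} {C τ : ℝ}
    (hB : ∀ k x, ‖B k x‖ ≤ C * ‖x‖) (hre : ∀ k x, (inner ℂ x (B k x)).re = ‖x‖ ^ 2)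
    (him : ∀ k x, |(inner ℂ x (B k x)).im| ≤ τ * ‖x‖ ^ 2) :
    LinGraph.IsElliptic (sumOp H (diagonalOp B C hB)) (WithLp.fstL 2 ℂ H (lp K 2)) where
  re_nonneg x := by rw [(inner_diagonal_mem hB hre him x).1]; positivity
  norm_sq_eq x := by
    rw [(inner_diagonal_mem hB hre him x).1, WithLp.prod_norm_sq_eq_of_L2]; rfl

end HilbertSum

/-! ### Embeddings of the form domains into the Hilbert sum -/

namespace SesqForm

variable {H : Type*} [NormedAddCommGroup H] [InnerProductSpace ℂ H]
variable {K : ℕ → Type*} [∀ k, NormedAddCommGroup (K k)] [∀ k, InnerProductSpace ℂ (K k)]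
variable {b : ℕ → SesqForm H}

theorem mem_domain_of_mem_partialSum {n k : ℕ} (h : k ≤ n) {u : H}
    (hu : u ∈ (partialSum b n).domain) : u ∈ (b k).domain :=
  (Submodule.mem_iInf _).1 hu ⟨k, Nat.lt_succ_of_le h⟩

theorem partialSum_domain_antitone (b : ℕ → SesqForm H) :
    Antitone fun n => (partialSum b n).domain := fun _ _ hmn _ hu =>
  (Submodule.mem_iInf _).2 fun k =>
    mem_domain_of_mem_partialSum ((Nat.le_of_lt_succ k.2).trans hmn) hu

section Embeddings

variable (q : ∀ k, (b k).domain →ₗ[ℂ] K k)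

/-- The embedding `u ↦ (u, (q_0 u, …, q_n u, 0, …))` of `D(𝔞_n)` into `H ⊕ ℓ²(K)`. -/
noncomputable def partialEmbed (n : ℕ) :
    (partialSum b n).domain →ₗ[ℂ] WithLp 2 (H × lp K 2) where
  toFun u := WithLp.toLp 2 ((u : H), ⟨fun k =>
      if h : k ≤ n then q k ⟨u, mem_domain_of_mem_partialSum h u.2⟩ else 0,
    memℓp_two_of_summable <| summable_of_ne_finset_zero (s := Finset.range (n + 1)) fun k hk => by
      rw [dif_neg fun h => hk (Finset.mem_range.2 (Nat.lt_succ_of_le h))]; simp⟩)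
  map_add' u v := hilbertSum_ext rfl fun k => by
    change (if h : k ≤ n then q k ⟨_, _⟩ else 0) =
      (if h : k ≤ n then q k ⟨_, _⟩ else 0) + (if h : k ≤ n then q k ⟨_, _⟩ else 0)
    split_ifs
    · exact map_add (q k) ⟨u, _⟩ ⟨v, _⟩
    · exact (add_zero 0).symm
  map_smul' c u := hilbertSum_ext rfl fun k => by
    change (if h : k ≤ n then q k ⟨_, _⟩ else 0) = c • (if h : k ≤ n then q k ⟨_, _⟩ else 0)
    split_ifs
    · exact map_smul (q k) c ⟨u, _⟩
    · exact (smul_zero c).symm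

theorem partialEmbed_snd (n : ℕ) (u : (partialSum b n).domain) (k : ℕ) :
    (partialEmbed q n u).snd k =
      if h : k ≤ n then q k ⟨u, mem_domain_of_mem_partialSum h u.2⟩ else 0 := rfl

theorem truncation_partialEmbed {m n : ℕ} (h : m ≤ n) (u : (partialSum b n).domain) :
    truncation H m (partialEmbed q n u)
      = partialEmbed q m ⟨u, partialSum_domain_antitone b h u.2⟩ :=
  hilbertSum_ext rfl fun k => by
    simp only [truncation_snd, partialEmbed_snd]
    by_cases hk : k ≤ m
    · rw [if_pos hk, dif_pos hk, dif_pos (hk.trans h)]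
    · rw [if_neg hk, dif_neg hk]

theorem isRealizedBy_partialEmbed {B : ∀ k, K k →L[ℂ] K k} {C : ℝ}
    (hB : ∀ k x, ‖B k x‖ ≤ C * ‖x‖)
    (hqB : ∀ k u v, inner ℂ (q k v) (B k (q k u)) = (b k).toFun u v) (n : ℕ) :
    (partialSum b n).IsRealizedBy (sumOp H (diagonalOp B C hB)) (WithLp.fstL 2 ℂ H (lp K 2))
      (partialEmbed q n) where
  map_eq u := rfl
  inner_eq u v := by
    rw [inner_sumOp, lp.inner_eq_tsum, partialSum_apply,
      tsum_eq_sum (s := Finset.range (n + 1)), Finset.sum_range]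
    · refine Finset.sum_congr rfl fun k _ => ?_
      rw [diagonalOp_apply, partialEmbed_snd, partialEmbed_snd,
        dif_pos (Nat.le_of_lt_succ k.2), dif_pos (Nat.le_of_lt_succ k.2), hqB]
    · intro k hk
      rw [partialEmbed_snd, dif_neg fun h => hk (Finset.mem_range.2 (Nat.lt_succ_of_le h)),
        inner_zero_left]

variable {θ : ℝ} (hb : ∀ n, (b n).IsSectorialWith 0 θ)

/-- The embedding `u ↦ (u, (q_k u)_k)` of `D(𝔞_∞)` into `H ⊕ ℓ²(K)`. -/
noncomputable def seriesEmbed (hq : ∀ k u, ‖q k u‖ ^ 2 = ((b k).toFun u u).re) :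
    (seriesForm b hb).domain →ₗ[ℂ] WithLp 2 (H × lp K 2) where
  toFun u := WithLp.toLp 2 ((u : H), ⟨fun k => q k ⟨u, seriesDomain_le hb k u.2⟩,
    memℓp_two_of_summable <| u.2.2.congr fun k => (hq k _).symm⟩)
  map_add' u v := hilbertSum_ext rfl fun k =>
    map_add (q k) ⟨u, seriesDomain_le hb k u.2⟩ ⟨v, seriesDomain_le hb k v.2⟩
  map_smul' c u := hilbertSum_ext rfl fun k => map_smul (q k) c ⟨u, seriesDomain_le hb k u.2⟩

variable {q}

theorem seriesEmbed_snd (hq : ∀ k u, ‖q k u‖ ^ 2 = ((b k).toFun u u).re)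
    (u : (seriesForm b hb).domain) (k : ℕ) :
    (seriesEmbed q hb hq u).snd k = q k ⟨u, seriesDomain_le hb k u.2⟩ := rfl

theorem isRealizedBy_seriesEmbed (hq : ∀ k u, ‖q k u‖ ^ 2 = ((b k).toFun u u).re)
    {B : ∀ k, K k →L[ℂ] K k} {C : ℝ} (hB : ∀ k x, ‖B k x‖ ≤ C * ‖x‖)
    (hqB : ∀ k u v, inner ℂ (q k v) (B k (q k u)) = (b k).toFun u v) :
    (seriesForm b hb).IsRealizedBy (sumOp H (diagonalOp B C hB)) (WithLp.fstL 2 ℂ H (lp K 2))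
      (seriesEmbed q hb hq) where
  map_eq u := rfl
  inner_eq u v := by
    rw [inner_sumOp, lp.inner_eq_tsum]
    exact tsum_congr fun k => hqB k _ _

theorem seriesForm_domain_le_partialSum (n : ℕ) :
    (seriesForm b hb).domain ≤ (partialSum b n).domain := fun _ hu =>
  (Submodule.mem_iInf _).2 fun k => seriesDomain_le hb k hu

theorem truncation_seriesEmbed (hq : ∀ k u, ‖q k u‖ ^ 2 = ((b k).toFun u u).re) (n : ℕ)
    (u : (seriesForm b hb).domain) :
    truncation H n (seriesEmbed q hb hq u)
      = partialEmbed q n ⟨u, seriesForm_domain_le_partialSum hb n u.2⟩ :=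
  hilbertSum_ext rfl fun k => by
    rw [truncation_snd, partialEmbed_snd]
    by_cases hk : k ≤ n
    · rw [if_pos hk, dif_pos hk, seriesEmbed_snd]
    · rw [if_neg hk, dif_neg hk]

variable (q) in
/-- The elements of `H ⊕ ℓ²(K)` whose `n`-th truncation is in the closure of the image of
`D(𝔞_n)`. -/
noncomputable def truncClosure (n : ℕ) : Submodule ℂ (WithLp 2 (H × lp K 2)) :=
  (LinearMap.range (partialEmbed q n)).topologicalClosure.comap
    (truncation (K := K) H n).toLinearMap

theorem mem_truncClosure {n : ℕ} {x : WithLp 2 (H × lp K 2)} : x ∈ truncClosure q n ↔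
    truncation H n x ∈ (LinearMap.range (partialEmbed q n)).topologicalClosure := Iff.rfl

variable (q) in
theorem isClosed_truncClosure (n : ℕ) :
    IsClosed (truncClosure q n : Set (WithLp 2 (H × lp K 2))) :=
  (Submodule.isClosed_topologicalClosure _).preimage (truncation (K := K) H n).continuous

theorem truncation_mem_of_mem {m n : ℕ} (h : m ≤ n) {x : WithLp 2 (H × lp K 2)}
    (hx : x ∈ (LinearMap.range (partialEmbed q n)).topologicalClosure) :
    truncation H m x ∈ (LinearMap.range (partialEmbed q m)).topologicalClosure := by
  refine map_mem_closure (truncation (K := K) H m).continuous hx ?_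
  rintro _ ⟨u, rfl⟩
  exact ⟨_, (truncation_partialEmbed q h u).symm⟩

variable (q) in
-- Truncating at n and then at m ≤ n is truncating at m, and the m-th truncation maps W_n into W_m.
theorem truncClosure_antitone : Antitone (truncClosure q) := fun m n hmn x hx => by
  have h := truncation_mem_of_mem hmn (mem_truncClosure.1 hx)
  have e : truncation H m (truncation H n x) = truncation H m x := hilbertSum_ext rfl fun k => by
    simp only [truncation_snd]
    by_cases hk : k ≤ m
    · rw [if_pos hk, if_pos hk, if_pos (hk.trans hmn)]
    · rw [if_neg hk, if_neg hk]
  rwa [e] at h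

theorem truncation_eq_of_mem {n : ℕ} {x : WithLp 2 (H × lp K 2)}
    (hx : x ∈ (LinearMap.range (partialEmbed q n)).topologicalClosure) : truncation H n x = x := by
  refine closure_minimal (t := {x | truncation H n x = x}) ?_
    (isClosed_eq (truncation (K := K) H n).continuous continuous_id) hx
  rintro _ ⟨u, rfl⟩
  exact truncation_partialEmbed q le_rfl u

theorem range_seriesEmbed_le (hq : ∀ k u, ‖q k u‖ ^ 2 = ((b k).toFun u u).re) :
    LinearMap.range (seriesEmbed q hb hq) ≤ ⨅ n, truncClosure q n := by
  rintro _ ⟨u, rfl⟩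
  refine (Submodule.mem_iInf _).2 fun n => mem_truncClosure.2 ?_
  rw [truncation_seriesEmbed]
  exact Submodule.le_topologicalClosure _ ⟨_, rfl⟩

/-- When the ranges are closed, each truncation of x comes from a vector of D(𝔞_n), necessarily the
H-component of x. Hence the n-th entry of x is the image of that component under `q n`, and square
summability of the entries is the convergence of ∑ Re b_n. -/
theorem range_seriesEmbed_eq (hq : ∀ k u, ‖q k u‖ ^ 2 = ((b k).toFun u u).re)
    (hcl : ∀ n, (LinearMap.range (partialEmbed q n)).topologicalClosure
      = LinearMap.range (partialEmbed q n)) :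
    LinearMap.range (seriesEmbed q hb hq) = ⨅ n, truncClosure q n := by
  refine le_antisymm (range_seriesEmbed_le hb hq) fun x hx => ?_
  have hx' : ∀ n, ∃ u, partialEmbed q n u = truncation H n x := fun n => by
    have := mem_truncClosure.1 ((Submodule.mem_iInf _).1 hx n)
    rwa [hcl] at this
  choose u hu using hx'
  have hfst : ∀ n, (u n : H) = x.fst := fun n => congrArg WithLp.fst (hu n)
  have hdom : ∀ n, x.fst ∈ (b n).domain := fun n =>
    hfst n ▸ mem_domain_of_mem_partialSum le_rfl (u n).2
  have hsnd : ∀ n, q n ⟨x.fst, hdom n⟩ = x.snd n := fun n => by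
    have h := congrArg (fun y => y.snd n) (hu n)
    simp only [truncation_snd, partialEmbed_snd, le_refl, if_true, dif_pos] at h
    rw [← h]
    simp only [hfst]
  refine ⟨⟨x.fst, hdom, (hasSum_norm_sq_lp x.snd).summable.congr fun n => ?_⟩,
    hilbertSum_ext rfl hsnd⟩
  rw [← hsnd, hq]

end Embeddings

end SesqForm

/-! ### Proof of the theorem -/

open SesqForm LinGraph in
/-- Monotone convergence for series of sectorial forms, given for each `b k` a Hilbert space `K k`
in which it is represented by an operator `B k`. -/
theorem partialSum_assocGraph_of_hilbertSum {H : Type*} [NormedAddCommGroup H]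
    [InnerProductSpace ℂ H] [CompleteSpace H] {θ : ℝ} {b : ℕ → SesqForm H} (hb : ∀ n, (b n).IsSectorialWith 0 θ)
    {K : ℕ → Type*} [∀ k, NormedAddCommGroup (K k)] [∀ k, InnerProductSpace ℂ (K k)]
    [∀ k, CompleteSpace (K k)] {q : ∀ k, (b k).domain →ₗ[ℂ] K k} {B : ∀ k, K k →L[ℂ] K k} {C : ℝ}
    (hB : ∀ k x, ‖B k x‖ ≤ C * ‖x‖) (hre : ∀ k x, (inner ℂ x (B k x)).re = ‖x‖ ^ 2)
    (him : ∀ k x, |(inner ℂ x (B k x)).im| ≤ Real.tan θ * ‖x‖ ^ 2)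
    (hqB : ∀ k u v, inner ℂ (q k v) (B k (q k u)) = (b k).toFun u v) :
    (∀ n, IsMSectorialWith ((partialSum b n).assocGraph (partialSum_isSectorial hb n)) 0 θ) ∧
    ∃ A : Submodule ℂ (H × H), IsMSectorialWith A 0 θ ∧
      StrongResolventTendsto
        (fun n => (partialSum b n).assocGraph (partialSum_isSectorial hb n)) A ∧
      (Dense ((seriesForm b hb).domain : Set H) →
        (∀ n, IsSingleValued ((partialSum b n).assocGraph (partialSum_isSectorial hb n))) ∧
        IsSingleValued A) ∧
      ((∀ n, (partialSum b n).IsClosedWith 0) →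
        (∀ n, (partialSum b n).assocGraph (partialSum_isSectorial hb n) =
          (partialSum b n).variationalGraph) ∧
        (seriesForm b hb).IsClosedWith 0 ∧
        A = (seriesForm b hb).assocGraph (seriesForm_isSectorial hb) ∧
        A = (seriesForm b hb).variationalGraph) := by
  obtain ⟨h0, hθ, -⟩ := hb 0
  have hell := isElliptic_diagonal (H := H) hB hre him
  set T := sumOp H (diagonalOp B C hB)
  set J := WithLp.fstL 2 ℂ H (lp K 2)
  have hsec : ∀ x, inner ℂ x (T x) ∈ sector θ := fun x => by
    obtain ⟨h1, h2⟩ := inner_diagonal_mem hB hre him x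
    exact (mem_sector_iff h0 hθ).2 ⟨by rw [h1]; positivity, by rw [h1]; exact h2⟩
  have hq : ∀ k u, ‖q k u‖ ^ 2 = ((b k).toFun u u).re := fun k u => by rw [← hre, hqB]
  have hn : ∀ n, (partialSum b n).IsRealizedBy T J (partialEmbed q n) :=
    isRealizedBy_partialEmbed q hB hqB
  have hs : (seriesForm b hb).IsRealizedBy T J (seriesEmbed q hb hq) :=
    isRealizedBy_seriesEmbed hb hq hB hqB
  have hG : ∀ n, (partialSum b n).assocGraph (partialSum_isSectorial hb n)
      = realized T J (truncClosure q n) := fun n => by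
    rw [← (hn n).realized_eq_assocGraph hell]
    refine hell.realized_eq_of_projection (P := truncation H n)
      (Submodule.isClosed_topologicalClosure _) (isClosed_truncClosure q n)
      (fun x hx => ?_) (fun x hx => hx) (fun x => rfl)
      fun ξ hξ η => inner_diagonal_truncation hB (truncation_eq_of_mem hξ) η
    rw [mem_truncClosure, truncation_eq_of_mem hx]
    exact hx
  have hcl := isClosed_truncClosure q
  have hcl' : IsClosed ((⨅ n, truncClosure q n :
      Submodule ℂ (WithLp 2 (H × lp K 2))) : Set (WithLp 2 (H × lp K 2))) := by
    rw [Submodule.coe_iInf]; exact isClosed_iInter hcl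
  -- The intersection contains the image of D(𝔞_∞), closed forms or not, so J maps it onto a set
  -- containing D(𝔞_∞).
  have hdom : ∀ {M : Submodule ℂ (WithLp 2 (H × lp K 2))}, ⨅ n, truncClosure q n ≤ M →
      Dense ((seriesForm b hb).domain : Set H) →
      Dense (M.map (J : WithLp 2 (H × lp K 2) →ₗ[ℂ] H) : Set H) := fun hM hd =>
    hd.mono fun u hu => ⟨seriesEmbed q hb hq ⟨u, hu⟩,
      hM (range_seriesEmbed_le hb hq ⟨_, rfl⟩), rfl⟩
  simp only [hG]
  refine ⟨fun n => hell.isMSectorialWith h0 hθ hsec (hcl n),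
    realized T J (⨅ n, truncClosure q n), hell.isMSectorialWith h0 hθ hsec hcl',
    hell.strongResolventTendsto (truncClosure_antitone q) hcl,
    fun hd => ⟨fun n => hell.isSingleValued (hdom (iInf_le _ n) hd),
      hell.isSingleValued (hdom le_rfl hd)⟩, fun hclosed => ?_⟩
  have hrange : LinearMap.range (seriesEmbed q hb hq) = ⨅ n, truncClosure q n :=
    range_seriesEmbed_eq hb hq fun n => (hn n).topologicalClosure_range hell (hclosed n)
  have hsc : (seriesForm b hb).IsClosedWith 0 :=
    (hs.isClosedWith_iff hell).2 (by rw [hrange]; exact hcl')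
  have hv : realized T J (⨅ n, truncClosure q n) = (seriesForm b hb).variationalGraph := by
    rw [← hrange, realized_range_eq_variationalGraph hs]
  refine ⟨fun n => ?_, hsc, ?_, hv⟩
  · rw [← hG, (hn n).assocGraph_eq_variationalGraph hell _ (hclosed n)]
  · rw [hv, hs.assocGraph_eq_variationalGraph hell _ hsc]

theorem theorem1p2 {H : Type*} [NormedAddCommGroup H] [InnerProductSpace ℂ H] [CompleteSpace H]
    (θ : ℝ) (b : ℕ → SesqForm H) (hb : ∀ n, (b n).IsSectorialWith 0 θ) :
    -- the series `∑ b_n(u, v)` converges on `D(𝔞_∞)`, and `𝔞_∞(u, v)` is its sum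
    (∀ u v : (SesqForm.seriesForm b hb).domain,
      HasSum (fun n => (b n).toFun ⟨u, SesqForm.seriesDomain_le hb n u.2⟩
          ⟨v, SesqForm.seriesDomain_le hb n v.2⟩)
        ((SesqForm.seriesForm b hb).toFun u v)) ∧
    -- the graphs `A_n` associated with the `𝔞_n` are `m`-sectorial
    (∀ n, LinGraph.IsMSectorialWith
      ((SesqForm.partialSum b n).assocGraph (SesqForm.partialSum_isSectorial hb n)) 0 θ) ∧
    -- and converge to an `m`-sectorial graph `A_∞`
    ∃ A : Submodule ℂ (H × H),
      LinGraph.IsMSectorialWith A 0 θ ∧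
      LinGraph.StrongResolventTendsto
        (fun n => (SesqForm.partialSum b n).assocGraph (SesqForm.partialSum_isSectorial hb n)) A ∧
      -- if `D(𝔞_∞)` is dense, then all the `A_n` and `A_∞` are operators
      (Dense ((SesqForm.seriesForm b hb).domain : Set H) →
        (∀ n, LinGraph.IsSingleValued
          ((SesqForm.partialSum b n).assocGraph (SesqForm.partialSum_isSectorial hb n))) ∧
        LinGraph.IsSingleValued A) ∧
      -- if all `𝔞_n` are closed, then `𝔞_∞` is closed and `A_∞` is associated with `𝔞_∞`
      ((∀ n, (SesqForm.partialSum b n).IsClosedWith 0) →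
        (∀ n, (SesqForm.partialSum b n).assocGraph (SesqForm.partialSum_isSectorial hb n) =
          (SesqForm.partialSum b n).variationalGraph) ∧
        (SesqForm.seriesForm b hb).IsClosedWith 0 ∧
        A = (SesqForm.seriesForm b hb).assocGraph (SesqForm.seriesForm_isSectorial hb) ∧
        A = (SesqForm.seriesForm b hb).variationalGraph) := by
  obtain ⟨h0, hθ, -⟩ := hb 0
  have hτ : 0 ≤ Real.tan θ := Real.tan_nonneg_of_nonneg_of_le_pi_div_two h0 hθ.le
  have him : ∀ k u, |((b k).toFun u u).im| ≤ Real.tan θ * ((b k).toFun u u).re := fun k u => by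
    simpa using ((mem_sector_iff h0 hθ).1 ((hb k).2.2 u)).2
  -- The bound on `B k` is 2(1 + tan θ) for every k, as the diagonal operator requires.
  choose K i1 i2 i3 q B hB hre hBim hqB using fun k =>
    exists_hilbertSpace_of_sectorial (b k).toFun hτ (hb k).re_nonneg (him k)
  exact ⟨fun u v => (SesqForm.summable_series hb u v).hasSum,
    partialSum_assocGraph_of_hilbertSum hb hB hre hBim hqB⟩
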